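/- Let $g\ge 0$ be a random variable with finite mean (the power gain of an interfering link), let $\lambda>0$, $\alpha>2$, $\mathrm{SNR}>0$, and for $s>0$ put $\mathcal M_I(s)=\mathbb E\{e^{-sg}\}$, $\mathcal M_I^{(k)}(s)=\mathbb E\{g^{k+1}e^{-sg}\}$, $$\mathcal Z_I(s)=\mathcal M_I(s)+\Gamma\!\left(1-\tfrac2\alpha\right)\sum_{k=0}^{\infty}\frac{s^{k+1}\mathcal M_I^{(k)}(s)}{\Gamma\left(2-\frac2\alpha+k\right)} .$$ For $y>0$ write $Z=\mathcal Z_I(\mathrm{SNR}\,y)$ and $$\mathcal G_I(y)=\frac1Z-\frac{\alpha}{2}\,\frac{y}{Z}\int_0^\infty \xi^{\frac\alpha2-1}e^{-\pi\lambda Z\xi}\,e^{-y\xi^{\alpha/2}}\,d\xi .$$ Then the series and the integral converge, $Z>0$, and: (a) if $\alpha=4$, then $$\mathcal G_I(y)=\frac{\pi\lambda}{2}\sqrt{\frac{\pi}{y}}\,\exp\!\left\{\frac{(\pi\lambda)^2Z^2}{4y}\right\}\mathrm{erfc}\!\left(\frac{\pi\lambda Z}{2\sqrt y}\right),\qquad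 \mathrm{erfc}(x)=\frac{2}{\sqrt\pi}\int_x^\infty e^{-\xi^2}d\xi;$$ (b) if $\alpha=6$, then $$\mathcal G_I(y)=2\pi\lambda\sqrt{\frac{\pi\lambda Z}{27y}}\;S_{0,1/3}\!\left(2\sqrt{\frac{(\pi\lambda)^3Z^3}{27y}}\right),$$ where $S_{\mu,\nu}$ is the Lommel function (the solution of $x^2w''+xw'+(x^2-\nu^2)w=x^{\mu+1}$ with $S_{\mu,\nu}(x)\sim x^{\mu-1}$ as $x\to+\infty$); (c) if $\alpha/2=\alpha_N/\alpha_D$ with positive integers $\alpha_N,\alpha_D$, then, with $\nu_\alpha=\frac\alpha2-1$, $$\mathcal G_I(y)=\frac1Z-\frac\alpha2\,\frac{y}{(\pi\lambda)^{\nu_\alpha+1}Z^{\nu_\alpha+2}}\,\frac{\sqrt{\alpha_D}\,\alpha_N^{\nu_\alpha+\frac12}}{(2\pi)^{\frac{\alpha_N+\alpha_D}{2}-1}}\;G^{\alpha_D,\alpha_N}_{\alpha_N,\alpha_D}\!\left(\frac{\alpha_N^{\alpha_N}y^{\alpha_D}}{\alpha_D^{\alpha_D}(\pi\lambda)^{\alpha_N}Z^{\alpha_N}}\,\middle|\,\begin{matrix}\Delta(\alpha_N,-\nu_\alpha)\\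 \Delta(\alpha_D,0)\end{matrix}\right),$$ where $\Delta(n,x)=\left[\frac xn,\frac{x+1}n,\dots,\frac{x+n-1}n\right]$ and $G^{m,n}_{p,q}$ is the Meijer G-function, $G^{m,n}_{p,q}\left(z\,\middle|\,{(a_p)\atop(b_q)}\right)=\frac1{2\pi i}\int_L\frac{\prod_{j\le m}\Gamma(b_j+s)\prod_{j\le n}\Gamma(1-a_j-s)}{\prod_{j>n}\Gamma(a_j+s)\prod_{j>m}\Gamma(1-b_j-s)}\,z^{-s}\,ds$, with $L$ a vertical line that has the poles of the $\Gamma(b_j+s)$, $j\le m$, on its left and those of the $\Gamma(1-a_j-s)$, $j\le n$, on its right. -/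

import Mathlib

noncomputable section

namespace CellularRate

open MeasureTheory

/-- The complementary Gauss error function. -/
def erfc (x : ℝ) : ℝ :=
  2 / √Real.pi * ∫ ξ in Set.Ioi x, Real.exp (-ξ ^ 2)

/-- The Bessel function of the first kind of real order `ν`, for `x > 0`. -/
def besselJ (ν x : ℝ) : ℝ :=
  ∑' k : ℕ, (-1) ^ k / ((k.factorial : ℝ) * Real.Gamma (ν + k + 1)) * (x / 2) ^ (2 * (k : ℝ) + ν)

/-- The Lommel function `s_{μ,ν}`, for `x > 0` (neither `μ + ν` nor `μ - ν` a negative odd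
integer). -/
def lommelLower (μ ν x : ℝ) : ℝ :=
  ∑' k : ℕ, (-1) ^ k * x ^ (μ + 1 + 2 * (k : ℝ)) /
    ∏ i ∈ Finset.range (k + 1), ((μ + 2 * (i : ℝ) + 1) ^ 2 - ν ^ 2)

/-- The Lommel function `S_{μ,ν}`, for `x > 0` and non-integer order `ν` (neither `μ + ν` nor
`μ - ν` a negative odd integer). -/
def lommelS (μ ν x : ℝ) : ℝ :=
  lommelLower μ ν x +
    2 ^ (μ - 1) * Real.Gamma ((μ - ν + 1) / 2) * Real.Gamma ((μ + ν + 1) / 2) /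
      Real.sin (ν * Real.pi) *
      (Real.cos ((μ - ν) / 2 * Real.pi) * besselJ (-ν) x -
        Real.cos ((μ + ν) / 2 * Real.pi) * besselJ ν x)

/-- The Mellin-Barnes kernel
`∏_{j ≤ m} Γ(b_j + s) ∏_{j ≤ n} Γ(1 - a_j - s) / (∏_{j > n} Γ(a_j + s) ∏_{j > m} Γ(1 - b_j - s))`
of the Meijer function `G^{m,n}_{p,q}`. (`Complex.Gamma` is `0` at its poles, so each inverse
is the entire function `1 / Γ`.) -/
def meijerKernel (m n : ℕ) {p q : ℕ} (a : Fin p → ℂ) (b : Fin q → ℂ) (s : ℂ) : ℂ :=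
  (∏ j : Fin q, if (j : ℕ) < m then Complex.Gamma (b j + s) else (Complex.Gamma (1 - b j - s))⁻¹) *
    ∏ j : Fin p, if (j : ℕ) < n then Complex.Gamma (1 - a j - s) else (Complex.Gamma (a j + s))⁻¹

/-- The upward vertical line `Re s = σ` is an admissible contour for `G^{m,n}_{p,q}(z)`: it has
all poles of the `Γ(b_j + s)`, `j ≤ m`, on its left, all poles of the `Γ(1 - a_j - s)`, `j ≤ n`,
on its right, and the Mellin-Barnes integral along it converges absolutely. -/
structure IsMeijerContour (m n : ℕ) {p q : ℕ} (a : Fin p → ℂ) (b : Fin q → ℂ) (z : ℂ)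
    (σ : ℝ) : Prop where
  left : ∀ j : Fin q, (j : ℕ) < m → -(b j).re < σ
  right : ∀ j : Fin p, (j : ℕ) < n → σ < 1 - (a j).re
  integrable : Integrable (fun t : ℝ =>
    meijerKernel m n a b (σ + t * Complex.I) * z ^ (-(σ + t * Complex.I)))

/-- `(2πi)⁻¹ ∫ (kernel at s) z^{-s} ds` along the line `s = σ + i t`, where `ds = i dt`. -/
def meijerLineIntegral (m n : ℕ) {p q : ℕ} (a : Fin p → ℂ) (b : Fin q → ℂ) (z : ℂ)
    (σ : ℝ) : ℂ :=
  (2 * (Real.pi : ℂ))⁻¹ * ∫ t : ℝ,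
    meijerKernel m n a b (σ + t * Complex.I) * z ^ (-(σ + t * Complex.I))

open Classical in
/-- The Meijer function `G^{m,n}_{p,q}(z | a ; b)`, for parameters and arguments that admit a
straight contour. By Cauchy's theorem the value does not depend on which one is taken. -/
def meijerG (m n : ℕ) {p q : ℕ} (a : Fin p → ℂ) (b : Fin q → ℂ) (z : ℂ) : ℂ :=
  if h : ∃ σ : ℝ, IsMeijerContour m n a b z σ then meijerLineIntegral m n a b z h.choose else 0

/-- `Δ(n, x) = [x / n, (x + 1) / n, …, (x + n - 1) / n]`. -/
def deltaList (n : ℕ) (x : ℝ) : Fin n → ℂ :=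
  fun i => (((x + (i : ℕ)) / n : ℝ) : ℂ)

variable {Ω : Type*} [MeasurableSpace Ω]

/-- `M_I(s) = E{exp(-s g)}`. -/
def mgfI (P : Measure Ω) (g : Ω → ℝ) (s : ℝ) : ℝ :=
  ProbabilityTheory.mgf g P (-s)

/-- `M_I^{(k)}(s) = E{g^{k+1} exp(-s g)}`. -/
def mgfDerivI (P : Measure Ω) (g : Ω → ℝ) (k : ℕ) (s : ℝ) : ℝ :=
  ∫ ω, g ω ^ (k + 1) * Real.exp (-s * g ω) ∂P

/-- The `k`-th term `s^{k+1} M_I^{(k)}(s) / Γ(2 - 2/α + k)` of the series in `T_I(s)`. -/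
def termI (P : Measure Ω) (g : Ω → ℝ) (α s : ℝ) (k : ℕ) : ℝ :=
  s ^ (k + 1) * mgfDerivI P g k s * (Real.Gamma (2 - 2 / α + k))⁻¹

/-- `T_I(s)`. -/
def TI (P : Measure Ω) (g : Ω → ℝ) (α s : ℝ) : ℝ :=
  Real.Gamma (1 - 2 / α) * ∑' k : ℕ, termI P g α s k

/-- `Z_I(s) = M_I(s) + T_I(s)`. -/
def ZI (P : Measure Ω) (g : Ω → ℝ) (α s : ℝ) : ℝ :=
  mgfI P g s + TI P g α s

/-- The integrand `ξ^{α/2-1} exp(-π lam Z ξ) exp(-y ξ^{α/2})` of the inner integral in `G_I`. -/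
def innerIntegrand (lam α Z y ξ : ℝ) : ℝ :=
  ξ ^ (α / 2 - 1) * Real.exp (-Real.pi * lam * Z * ξ) * Real.exp (-y * ξ ^ (α / 2))

/-- `G_I(y)`, for density `lam`, path-loss exponent `α` and signal-to-noise ratio `snr`. -/
def GI (P : Measure Ω) (g : Ω → ℝ) (lam α snr y : ℝ) : ℝ :=
  1 / ZI P g α (snr * y) - α / 2 * (y / ZI P g α (snr * y)) *
    ∫ ξ in Set.Ioi (0 : ℝ), innerIntegrand lam α (ZI P g α (snr * y)) y ξ

end CellularRate

end

noncomputable section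

namespace CellularRate

open Filter Topology MeasureTheory

/-! ### The Gauss multiplication formula for the Gamma function -/

/-! Put `c = πλZ` and `r = α/2`. Integration by parts (`GI_eq_integral`) turns `G_I` into `πλ ∫
e^{-cξ} e^{-yξ^r} dξ`, which serves (a) and (b). For `r = 2`, completing the square gives erfc. For
`r = 3`, `e^{-cξ}` is expanded and integrated termwise; the residue classes 0, 1, 2 of the index mod
3 give the series of `J_{-1/3}`, `J_{1/3}` and the lower Lommel function, which combine to
`S_{0,1/3}`.

Part (c) keeps the original integral. Replacing `e^{-yξ^r}` by its Mellin inversion integral and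
applying Fubini yields a Barnes integral of `Γ(w) Γ(r(1-w))` (`integral_barnesIntegrand`). With `r =
N/D` and `w = Ds`, the Gauss multiplication formula `prod_Gamma_add_div` splits the two Gamma
factors into the products prescribed by the `Δ` lists (`meijerG_deltaList`).

The series converges because `Γ(2 - 2/α + k)` dominates a multiple of `k!`, and with `k!` in its
place the sum is at most `s E g`. -/

theorem prod_range_mul_add (m : ℕ) (hm : m ≠ 0) (s : ℂ) (k : ℕ) :
    ∏ l ∈ Finset.range (m * k), ((m : ℂ) * s + l) =
      (m : ℂ) ^ (m * k) *
        ∏ j ∈ Finset.range m, ∏ i ∈ Finset.range k, (s + (j : ℂ) / m + i) := by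
  have hm' : (m : ℂ) ≠ 0 := by exact_mod_cast hm
  induction k with
  | zero => simp
  | succ k ih =>
    rw [Nat.mul_succ, Finset.prod_range_add, ih, pow_add]
    simp_rw [Finset.prod_range_succ]
    rw [Finset.prod_mul_distrib, mul_mul_mul_comm]
    congr 1
    have hpow : (m : ℂ) ^ m = ∏ _j ∈ Finset.range m, (m : ℂ) := by simp
    rw [hpow, ← Finset.prod_mul_distrib]
    refine Finset.prod_congr rfl fun j _ => ?_
    push_cast
    field_simp
    ring

/-- The factor between the Euler approximants of the two sides of the multiplication formula. -/
def gaussFactor (m n : ℕ) : ℂ :=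
  (∏ j ∈ Finset.range m, (n : ℂ) ^ ((j : ℂ) / m)) * (n.factorial : ℂ) ^ m *
    (m : ℂ) ^ (m * (n + 1)) / ((m * n + (m - 1)).factorial : ℂ)

/-- At index `m n + (m - 1)` the Euler approximant of `Γ(ms)` has `m (n + 1)` linear factors in its
denominator, exactly matching the `m` denominators on the left. What remains, `gaussFactor`, is free
of `s`. -/
theorem prod_gammaSeq (m : ℕ) (hm : m ≠ 0) (s : ℂ) {n : ℕ} (hn : n ≠ 0) :
    ∏ j ∈ Finset.range m, Complex.GammaSeq (s + (j : ℂ) / m) n =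
      gaussFactor m n *
        ((((n : ℝ) / ((m * n + (m - 1) : ℕ) : ℝ) : ℝ) : ℂ) ^ ((m : ℂ) * s) *
          Complex.GammaSeq (m * s) (m * n + (m - 1))) := by
  have hm' : (m : ℂ) ≠ 0 := by exact_mod_cast hm
  have hn' : (n : ℂ) ≠ 0 := by exact_mod_cast hn
  have hK : m * n + (m - 1) + 1 = m * (n + 1) := by
    rw [mul_add]; omega
  have hKpos : 0 < m * n + (m - 1) := by positivity
  have h1 : ((((n : ℝ) / ((m * n + (m - 1) : ℕ) : ℝ) : ℝ) : ℂ) ^ ((m : ℂ) * s)) *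
      ((m * n + (m - 1) : ℕ) : ℂ) ^ ((m : ℂ) * s) = ((n : ℂ) ^ s) ^ m := by
    have := Complex.mul_cpow_ofReal_nonneg (a := (n : ℝ) / ((m * n + (m - 1) : ℕ) : ℝ))
      (b := ((m * n + (m - 1) : ℕ) : ℝ)) (by positivity) (by positivity) ((m : ℂ) * s)
    rw [Complex.ofReal_natCast] at this
    rw [← this, ← Complex.cpow_nat_mul, ← Complex.ofReal_natCast, ← Complex.ofReal_mul,
      div_mul_cancel₀ _ (by exact_mod_cast hKpos.ne'), Complex.ofReal_natCast]
  simp only [Complex.GammaSeq, gaussFactor]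
  rw [hK, prod_range_mul_add m hm, Finset.prod_div_distrib, Finset.prod_mul_distrib,
    Finset.prod_const, Finset.card_range]
  have h2 : ∏ j ∈ Finset.range m, (n : ℂ) ^ (s + (j : ℂ) / m) =
      ((n : ℂ) ^ s) ^ m * ∏ j ∈ Finset.range m, (n : ℂ) ^ ((j : ℂ) / m) := by
    simp_rw [Complex.cpow_add _ _ hn']
    rw [Finset.prod_mul_distrib, Finset.prod_const, Finset.card_range]
  rw [h2, ← h1]
  have hf : ((m * n + (m - 1)).factorial : ℂ) ≠ 0 := by exact_mod_cast Nat.factorial_ne_zero _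
  generalize ∏ j ∈ Finset.range m, ∏ i ∈ Finset.range (n + 1), (s + (j : ℂ) / m + i) = W
  have hmp : (m : ℂ) ^ (m * (n + 1)) ≠ 0 := pow_ne_zero _ hm'
  -- `W = 0` occurs when `ms` is a small nonpositive integer; division by zero then makes both sides
  -- `0`.
  rcases eq_or_ne W 0 with hW | hW
  · simp [hW]
  · field_simp

theorem tendsto_gaussRatio (m : ℕ) (hm : m ≠ 0) :
    Tendsto (fun n : ℕ => (n : ℝ) / ((m * n + (m - 1) : ℕ) : ℝ)) atTop (𝓝 (1 / (m : ℝ))) := by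
  have hm' : (m : ℝ) ≠ 0 := by exact_mod_cast hm
  have h : Tendsto (fun n : ℕ => ((m : ℝ) + ((m - 1 : ℕ) : ℝ) / (n : ℝ))⁻¹) atTop
      (𝓝 ((m : ℝ) + 0)⁻¹) :=
    (tendsto_const_nhds.add (tendsto_const_div_atTop_nhds_zero_nat _)).inv₀ (by simpa using hm')
  rw [add_zero, ← one_div] at h
  refine h.congr' ?_
  filter_upwards [eventually_ne_atTop 0] with n hn
  have hn' : (n : ℝ) ≠ 0 := by exact_mod_cast hn
  push_cast
  field_simp

/-- Since `gaussFactor` does not involve `s`, its convergence can be read off at `s = 1`, where the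
limit of the other factor is nonzero. Uniqueness of limits then covers every `s`, poles included. -/
theorem exists_prod_Gamma_eq (m : ℕ) (hm : m ≠ 0) :
    ∃ C : ℂ, ∀ s : ℂ, ∏ j ∈ Finset.range m, Complex.Gamma (s + (j : ℂ) / m) =
      C * (((1 / (m : ℝ) : ℝ) : ℂ) ^ ((m : ℂ) * s) * Complex.Gamma (m * s)) := by
  have hmpos : (0 : ℝ) < 1 / m := by positivity
  have hP (s : ℂ) : Tendsto (fun n => ∏ j ∈ Finset.range m, Complex.GammaSeq (s + (j : ℂ) / m) n)
      atTop (𝓝 (∏ j ∈ Finset.range m, Complex.Gamma (s + (j : ℂ) / m))) :=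
    tendsto_finsetProd _ fun j _ => Complex.GammaSeq_tendsto_Gamma _
  have hK : Tendsto (fun n : ℕ => m * n + (m - 1)) atTop atTop :=
    tendsto_atTop_mono (fun n => (Nat.le_mul_of_pos_left n (Nat.pos_of_ne_zero hm)).trans
      (Nat.le_add_right _ _)) tendsto_id
  have hR (s : ℂ) : Tendsto (fun n : ℕ =>
      (((n : ℝ) / ((m * n + (m - 1) : ℕ) : ℝ) : ℝ) : ℂ) ^ ((m : ℂ) * s) *
          Complex.GammaSeq (m * s) (m * n + (m - 1))) atTop
      (𝓝 (((1 / (m : ℝ) : ℝ) : ℂ) ^ ((m : ℂ) * s) * Complex.Gamma (m * s))) := by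
    refine Tendsto.mul ?_ ((Complex.GammaSeq_tendsto_Gamma _).comp hK)
    have hc : ContinuousAt (fun z : ℂ => z ^ ((m : ℂ) * s)) ((1 / (m : ℝ) : ℝ) : ℂ) :=
      continuousAt_cpow_const (Complex.ofReal_mem_slitPlane.2 hmpos)
    exact hc.tendsto.comp
      ((Complex.continuous_ofReal.tendsto _).comp (tendsto_gaussRatio m hm))
  have hne : ((1 / (m : ℝ) : ℝ) : ℂ) ^ ((m : ℂ) * 1) * Complex.Gamma (m * 1) ≠ 0 := by
    refine mul_ne_zero ?_ (Complex.Gamma_ne_zero_of_re_pos ?_)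
    · rw [Complex.cpow_def_of_ne_zero (by exact_mod_cast hmpos.ne')]
      exact Complex.exp_ne_zero _
    · simpa using Nat.pos_of_ne_zero hm
  have hC := ((hP 1).div (hR 1) hne).congr' (f₂ := gaussFactor m) (by
    filter_upwards [eventually_ne_atTop 0, (hR 1).eventually_ne hne] with n hn hRn
    rw [Pi.div_apply, prod_gammaSeq m hm 1 hn, mul_div_cancel_right₀ _ hRn])
  refine ⟨_, fun s => tendsto_nhds_unique (hP s) ((hC.mul (hR s)).congr' ?_)⟩
  filter_upwards [eventually_ne_atTop 0] with n hn
  rw [prod_gammaSeq m hm s hn]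

/-- Norms in `∏ (1 - ζ^j) = M + 1` for a primitive root `ζ` of order `M + 1`, with `|1 - e^{2iθ}| =
2 sin θ` on `[0, π]`. -/
theorem prod_two_mul_sin (M : ℕ) :
    ∏ j ∈ Finset.range M, (2 * Real.sin (Real.pi * (((j : ℝ) + 1) / (M + 1)))) = M + 1 := by
  have h := (Complex.isPrimitiveRoot_exp (M + 1) M.succ_ne_zero).prod_one_sub_pow_eq_order
  have h' := congrArg norm h
  rw [norm_prod] at h'
  have h3 : ‖(M : ℂ) + 1‖ = M + 1 := by
    rw [← Nat.cast_succ, Complex.norm_natCast]; simp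
  rw [h3] at h'
  refine Eq.trans ?_ h'
  refine Finset.prod_congr rfl fun j hj => ?_
  have hj' : (j : ℝ) < M := by exact_mod_cast Finset.mem_range.1 hj
  have hM : (M : ℂ) + 1 ≠ 0 := by exact_mod_cast M.succ_ne_zero
  have he : Complex.exp (2 * Real.pi * Complex.I / ((M + 1 : ℕ) : ℂ)) ^ (j + 1) =
      Complex.exp (Complex.I * ((2 * (Real.pi * (((j : ℝ) + 1) / (M + 1))) : ℝ) : ℂ)) := by
    rw [← Complex.exp_nat_mul]
    congr 1
    push_cast
    field_simp
  rw [he, norm_sub_rev, Complex.norm_exp_I_mul_ofReal_sub_one, mul_div_cancel_left₀ _ two_ne_zero,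
    Real.norm_of_nonneg]
  refine mul_nonneg zero_le_two (Real.sin_nonneg_of_nonneg_of_le_pi ?_ ?_)
  · exact mul_nonneg Real.pi_pos.le (by positivity)
  refine mul_le_of_le_one_right Real.pi_pos.le ?_
  rw [div_le_one (by positivity)]
  linarith

/-- Multiplying the product by its own reversal pairs `Γ(x)` with `Γ(1 - x)`; the reflection formula
then reduces the square to the sine product. -/
theorem prod_Gamma_div (M : ℕ) :
    ∏ j ∈ Finset.range M, Real.Gamma (((j : ℝ) + 1) / (M + 1)) =
      √((2 * Real.pi) ^ M / (M + 1)) := by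
  set Q := ∏ j ∈ Finset.range M, Real.Gamma (((j : ℝ) + 1) / (M + 1)) with hQ
  have hQpos : 0 ≤ Q := Finset.prod_nonneg fun j _ => (Real.Gamma_pos_of_pos (by positivity)).le
  have hrefl : Q = ∏ j ∈ Finset.range M, Real.Gamma (1 - ((j : ℝ) + 1) / (M + 1)) := by
    rw [hQ, ← Finset.prod_range_reflect]
    refine Finset.prod_congr rfl fun j hj => ?_
    have hj' := Finset.mem_range.1 hj
    have : ((M - 1 - j : ℕ) : ℝ) = M - 1 - j := by
      rw [Nat.sub_sub, Nat.cast_sub (by omega)]; push_cast; ring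
    rw [this]
    congr 1
    field_simp
    ring
  have hsq : Q ^ 2 = (2 * Real.pi) ^ M / (M + 1) := by
    rw [sq]
    nth_rewrite 2 [hrefl]
    have hpow : (2 * Real.pi) ^ M = ∏ _j ∈ Finset.range M, (2 * Real.pi) := by simp
    rw [hQ, ← Finset.prod_mul_distrib]
    refine Eq.trans ?_ (congrArg _ (prod_two_mul_sin M))
    rw [hpow, ← Finset.prod_div_distrib]
    simp_rw [Real.Gamma_mul_Gamma_one_sub]
    refine Finset.prod_congr rfl fun j _ => ?_
    rw [mul_div_mul_left _ _ two_ne_zero]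
  rw [← hsq, Real.sqrt_sq hQpos]

/-- The **Gauss multiplication formula**. -/
theorem prod_Gamma_add_div (m : ℕ) (hm : m ≠ 0) (s : ℂ) :
    ∏ j ∈ Finset.range m, Complex.Gamma (s + (j : ℂ) / m) =
      (((2 * Real.pi) ^ (((m : ℝ) - 1) / 2) * √(m : ℝ) : ℝ) : ℂ) *
        ((m : ℂ) ^ (-((m : ℂ) * s)) * Complex.Gamma (m * s)) := by
  obtain ⟨C, hC⟩ := exists_prod_Gamma_eq m hm
  have hm' : (m : ℂ) ≠ 0 := by exact_mod_cast hm
  have hbase (w : ℂ) : ((1 / (m : ℝ) : ℝ) : ℂ) ^ w = (m : ℂ) ^ (-w) := by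
    rw [Complex.cpow_neg, one_div, Complex.ofReal_inv, Complex.ofReal_natCast, Complex.inv_cpow]
    rw [Complex.natCast_arg]
    exact Real.pi_pos.ne
  have hval : C = (((2 * Real.pi) ^ (((m : ℝ) - 1) / 2) * √(m : ℝ) : ℝ) : ℂ) := by
    obtain ⟨M, rfl⟩ := Nat.exists_eq_succ_of_ne_zero hm
    -- At `s = 1/m` both `Γ(ms)` and the last factor of the product are `Γ(1)`, so the constant
    -- comes from `prod_Gamma_div`.
    have h := hC (1 / ((M + 1 : ℕ) : ℂ))
    rw [mul_one_div_cancel hm', Complex.Gamma_one, mul_one, Complex.cpow_one,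
      Finset.prod_range_succ] at h
    have hlast : (1 : ℂ) / ((M + 1 : ℕ) : ℂ) + (M : ℂ) / ((M + 1 : ℕ) : ℂ) = 1 := by
      rw [← add_div, div_eq_one_iff_eq hm']; push_cast; ring
    have hprod : ∏ j ∈ Finset.range M,
        Complex.Gamma (1 / ((M + 1 : ℕ) : ℂ) + (j : ℂ) / ((M + 1 : ℕ) : ℂ)) =
          ((√((2 * Real.pi) ^ M / (M + 1)) : ℝ) : ℂ) := by
      rw [← prod_Gamma_div, Complex.ofReal_prod]
      refine Finset.prod_congr rfl fun j _ => ?_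
      rw [← Complex.Gamma_ofReal]
      congr 1
      push_cast
      ring
    rw [hlast, Complex.Gamma_one, mul_one, hprod] at h
    have hreal : (2 * Real.pi) ^ ((((M + 1 : ℕ) : ℝ) - 1) / 2) * √((M + 1 : ℕ) : ℝ) =
        √((2 * Real.pi) ^ M / (M + 1)) * ((M : ℝ) + 1) := by
      have hM0 : (0 : ℝ) < M + 1 := by positivity
      have hs : √((2 * Real.pi) ^ M) = (2 * Real.pi) ^ ((M : ℝ) / 2) := by
        rw [Real.sqrt_eq_rpow, ← Real.rpow_natCast_mul (by positivity), mul_one_div]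
      rw [Real.sqrt_div (by positivity), hs]
      push_cast
      have : √((M : ℝ) + 1) * √((M : ℝ) + 1) = M + 1 := Real.mul_self_sqrt hM0.le
      rw [div_mul_eq_mul_div, eq_div_iff (Real.sqrt_pos.2 hM0).ne', mul_assoc, this]
      congr 2
      ring
    rw [Nat.succ_eq_add_one, hreal, Complex.ofReal_mul, h]
    push_cast
    field_simp
  rw [hC s, hval, hbase]

/-! ### Mellin inversion of the exponential function -/

theorem norm_Gamma_le {s : ℂ} (hs : 0 < s.re) : ‖Complex.Gamma s‖ ≤ Real.Gamma s.re := by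
  rw [Complex.Gamma_eq_integral hs, Complex.GammaIntegral, Real.Gamma_eq_integral hs]
  refine (norm_integral_le_integral_norm _).trans_eq ?_
  refine setIntegral_congr_fun measurableSet_Ioi fun x hx => ?_
  have hx' : 0 < x := hx
  simp only [norm_mul, Complex.norm_real, Real.norm_eq_abs, Real.abs_exp]
  rw [Complex.norm_cpow_eq_rpow_re_of_pos hx']
  simp

theorem continuous_Gamma_vertical {σ : ℝ} (hσ : 0 < σ) :
    Continuous fun t : ℝ => Complex.Gamma (σ + t * Complex.I) := by
  refine continuous_iff_continuousAt.2 fun t => ?_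
  have h : DifferentiableAt ℂ Complex.Gamma (σ + t * Complex.I) := by
    refine Complex.differentiableAt_Gamma _ fun m hm => ?_
    have := congrArg Complex.re hm
    simp at this
    have h0 : (0 : ℝ) ≤ m := m.cast_nonneg
    linarith
  exact ContinuousAt.comp (f := fun t : ℝ => (σ : ℂ) + t * Complex.I) h.continuousAt
    (by fun_prop)

/-- Quadratic decay suffices: `Γ(s) = Γ(s+2) / (s(s+1))`, where the numerator is bounded by `Γ(σ+2)`
and `|s(s+1)| ≥ |s|² = σ² + t²`. -/
theorem integrable_Gamma_vertical {σ : ℝ} (hσ : 0 < σ) :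
    Integrable fun t : ℝ => Complex.Gamma (σ + t * Complex.I) := by
  set m : ℝ := min 1 (σ ^ 2) with hm
  have hmpos : 0 < m := lt_min one_pos (by positivity)
  refine (integrable_inv_one_add_sq.const_mul (Real.Gamma (σ + 2) / m)).mono'
    (continuous_Gamma_vertical hσ).aestronglyMeasurable (Eventually.of_forall fun t => ?_)
  set s : ℂ := σ + t * Complex.I with hs
  have hre : s.re = σ := by simp [hs]
  have him : s.im = t := by simp [hs]
  have hs0 : s ≠ 0 := fun h => by rw [h] at hre; simp at hre; linarith
  have hs1 : s + 1 ≠ 0 := fun h => by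
    have := congrArg Complex.re h
    simp [hre] at this; linarith
  have hG : Complex.Gamma (s + 2) = (s + 1) * (s * Complex.Gamma s) := by
    rw [← Complex.Gamma_add_one s hs0, ← Complex.Gamma_add_one (s + 1) hs1]
    congr 1; ring
  have hle : ‖s‖ * ‖s‖ ≤ ‖s + 1‖ * ‖s‖ := by
    refine mul_le_mul_of_nonneg_right ?_ (norm_nonneg _)
    refine Real.le_sqrt_of_sq_le ?_ |>.trans_eq (Complex.norm_def _).symm
    rw [← Complex.normSq_eq_norm_sq, Complex.normSq_apply, Complex.normSq_apply]
    simp [hre, him]; nlinarith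
  have hsq : ‖s‖ * ‖s‖ = σ ^ 2 + t ^ 2 := by
    rw [← sq, ← Complex.normSq_eq_norm_sq, Complex.normSq_apply, hre, him]; ring
  have hmb : m * (1 + t ^ 2) ≤ σ ^ 2 + t ^ 2 := by
    have h1 : m ≤ 1 := min_le_left _ _
    have h2 : m ≤ σ ^ 2 := min_le_right _ _
    nlinarith [sq_nonneg t]
  have hb : ‖Complex.Gamma (s + 2)‖ ≤ Real.Gamma (σ + 2) := by
    have := norm_Gamma_le (s := s + 2) (by simp [hre]; linarith)
    simpa [hre] using this
  have hk : m * (1 + t ^ 2) * ‖Complex.Gamma s‖ ≤ Real.Gamma (σ + 2) := by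
    refine le_trans ?_ hb
    rw [hG, norm_mul, norm_mul, ← mul_assoc]
    exact mul_le_mul_of_nonneg_right (by linarith) (norm_nonneg _)
  rw [← div_eq_mul_inv, div_div, le_div_iff₀ (by positivity)]
  linarith

theorem integral_cpow_mul_Gamma_vertical {σ x : ℝ} (hσ : 0 < σ) (hx : 0 < x) :
    ∫ t : ℝ, (x : ℂ) ^ (-((σ : ℂ) + t * Complex.I)) * Complex.Gamma (σ + t * Complex.I) =
      2 * Real.pi * Real.exp (-x) := by
  have hmel : ∀ s : ℂ, 0 < s.re → mellin (fun x : ℝ => ((Real.exp (-x) : ℝ) : ℂ)) s =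
      Complex.Gamma s := fun s hs => by
    rw [Complex.Gamma_eq_integral hs, Complex.GammaIntegral_eq_mellin]
  have hline : (fun t : ℝ => mellin (fun x : ℝ => ((Real.exp (-x) : ℝ) : ℂ)) (σ + t * Complex.I)) =
      fun t : ℝ => Complex.Gamma (σ + t * Complex.I) :=
    funext fun t => hmel _ (by simpa using hσ)
  have hconv : MellinConvergent (fun x : ℝ => ((Real.exp (-x) : ℝ) : ℂ)) (σ : ℂ) := by
    refine (Complex.GammaIntegral_convergent (s := σ) (by simpa using hσ)).congr_fun
      (fun x _ => ?_) measurableSet_Ioi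
    simp only [smul_eq_mul]
    exact mul_comm _ _
  have h := mellinInv_mellin_eq σ (fun x : ℝ => ((Real.exp (-x) : ℝ) : ℂ)) hx hconv
    (by rw [Complex.VerticalIntegrable, hline]; exact integrable_Gamma_vertical hσ)
    (by fun_prop)
  have hpt : ∀ t : ℝ, mellin (fun x : ℝ => ((Real.exp (-x) : ℝ) : ℂ)) (σ + t * Complex.I) =
    Complex.Gamma (σ + t * Complex.I) := fun t => congrFun hline t
  simp only [mellinInv, hpt, smul_eq_mul] at h
  rw [← h, Complex.real_smul, ← mul_assoc]
  have : (2 * (Real.pi : ℂ)) * ((1 / (2 * Real.pi) : ℝ) : ℂ) = 1 := by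
    push_cast
    have := Real.pi_ne_zero
    field_simp
  rw [this, one_mul]

theorem ofReal_cpow_eq_exp {x : ℝ} (hx : 0 < x) (w : ℂ) :
    (x : ℂ) ^ w = Complex.exp ((Real.log x : ℝ) * w) := by
  rw [Complex.cpow_def_of_ne_zero (by exact_mod_cast hx.ne'), Complex.ofReal_log hx.le]

/-! ### The Mellin-Barnes representation of the inner integral -/

/-- The integrand of the Mellin-Barnes representation of
`∫ ξ in Ioi 0, ξ ^ (r - 1) * exp (-c ξ) * exp (-y ξ ^ r)`. -/
def barnesIntegrand (r c y : ℝ) (w : ℂ) : ℂ :=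
  (y : ℂ) ^ (-w) * Complex.Gamma w *
    ((1 / (c : ℂ)) ^ ((r : ℂ) * (1 - w)) * Complex.Gamma (r * (1 - w)))

/-- The strip `0 < σ < 1` puts both `w` and `r(1-w)` in the right half-plane; `Γ(w)` supplies the
decay, all other factors are bounded on the line. -/
theorem integrable_barnesIntegrand {r c y σ : ℝ} (hr : 0 < r) (hc : 0 < c) (hy : 0 < y)
    (hσ : 0 < σ) (hσ1 : σ < 1) :
    Integrable fun t : ℝ => barnesIntegrand r c y (σ + t * Complex.I) := by
  have hinv : (1 / (c : ℂ)) = ((1 / c : ℝ) : ℂ) := by push_cast; rfl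
  have hc' : (0 : ℝ) < 1 / c := by positivity
  have hyc : (y : ℂ) ∈ Complex.slitPlane := Complex.ofReal_mem_slitPlane.2 hy
  have hcc : ((1 / c : ℝ) : ℂ) ∈ Complex.slitPlane := Complex.ofReal_mem_slitPlane.2 hc'
  have hcontG : Continuous fun t : ℝ =>
      Complex.Gamma ((r : ℂ) * (1 - ((σ : ℂ) + t * Complex.I))) := by
    have h := (continuous_Gamma_vertical (σ := r * (1 - σ)) (by nlinarith)).comp
      (continuous_const_mul (-r))
    refine h.congr fun t => ?_
    simp only [Function.comp_apply]
    congr 1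
    push_cast
    ring
  have hcont : Continuous fun t : ℝ => barnesIntegrand r c y (σ + t * Complex.I) := by
    unfold barnesIntegrand
    rw [hinv]
    refine Continuous.mul (Continuous.mul ?_ (continuous_Gamma_vertical hσ))
      (Continuous.mul ?_ hcontG)
    · exact Continuous.const_cpow (by fun_prop) (Or.inl (Complex.slitPlane_ne_zero hyc))
    · exact Continuous.const_cpow (by fun_prop) (Or.inl (Complex.slitPlane_ne_zero hcc))
  refine ((integrable_Gamma_vertical hσ).norm.const_mul
    (y ^ (-σ) * ((1 / c) ^ (r * (1 - σ)) * Real.Gamma (r * (1 - σ))))).mono'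
      hcont.aestronglyMeasurable (Eventually.of_forall fun t => ?_)
  have hre : ((r : ℂ) * (1 - ((σ : ℂ) + t * Complex.I))).re = r * (1 - σ) := by simp
  have h1 : ‖Complex.Gamma ((r : ℂ) * (1 - ((σ : ℂ) + t * Complex.I)))‖ ≤
      Real.Gamma (r * (1 - σ)) := by
    have := norm_Gamma_le (s := (r : ℂ) * (1 - ((σ : ℂ) + t * Complex.I)))
      (by rw [hre]; nlinarith)
    rwa [hre] at this
  unfold barnesIntegrand
  rw [hinv, norm_mul, norm_mul, norm_mul, Complex.norm_cpow_eq_rpow_re_of_pos hy,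
    Complex.norm_cpow_eq_rpow_re_of_pos hc', hre]
  have h2 : (-((σ : ℂ) + t * Complex.I)).re = -σ := by simp
  rw [h2]
  calc _ ≤ y ^ (-σ) * ‖Complex.Gamma (σ + t * Complex.I)‖ *
        ((1 / c) ^ (r * (1 - σ)) * Real.Gamma (r * (1 - σ))) := by gcongr
    _ = _ := by ring

/-- Fubini for `F`: integrating in `ξ` first is a Gamma integral, integrating in `t` first is Mellin
inversion of the exponential at `y ξ^r`. -/
theorem integral_barnesIntegrand {r c y σ : ℝ} (hr : 0 < r) (hc : 0 < c) (hy : 0 < y)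
    (hσ : 0 < σ) (hσ1 : σ < 1) :
    ∫ t : ℝ, barnesIntegrand r c y (σ + t * Complex.I) =
      2 * Real.pi * ((∫ ξ in Set.Ioi (0 : ℝ),
        ξ ^ (r - 1) * Real.exp (-c * ξ) * Real.exp (-y * ξ ^ r) : ℝ) : ℂ) := by
  set F : ℝ → ℝ → ℂ := fun ξ t =>
    ((ξ : ℂ) ^ ((r : ℂ) * (1 - ((σ : ℂ) + t * Complex.I)) - 1) * Complex.exp (-(c * ξ))) *
      ((y : ℂ) ^ (-((σ : ℂ) + t * Complex.I)) * Complex.Gamma (σ + t * Complex.I)) with hF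
  have hre (t : ℝ) : ((r : ℂ) * (1 - ((σ : ℂ) + t * Complex.I)) - 1).re = r * (1 - σ) - 1 := by
    simp
  have hFint : Integrable (Function.uncurry F) ((volume.restrict (Set.Ioi (0 : ℝ))).prod volume) := by
    have h1 : Integrable (fun ξ : ℝ => ξ ^ (r * (1 - σ) - 1) * Real.exp (-c * ξ))
        (volume.restrict (Set.Ioi (0 : ℝ))) := by
      have := integrableOn_rpow_mul_exp_neg_mul_rpow (p := 1) (s := r * (1 - σ) - 1) (b := c)
        (by nlinarith) one_pos hc
      simpa [IntegrableOn] using this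
    have h2 : Integrable (fun t : ℝ => y ^ (-σ) * ‖Complex.Gamma (σ + t * Complex.I)‖) :=
      (integrable_Gamma_vertical hσ).norm.const_mul _
    refine (h1.mul_prod h2).mono' ?_ ?_
    · have hG := (continuous_Gamma_vertical hσ).measurable
      have hG2 : Measurable fun p : ℝ × ℝ => Complex.Gamma (σ + p.2 * Complex.I) :=
        hG.comp measurable_snd
      refine Measurable.aestronglyMeasurable ?_
      refine Measurable.mul (Measurable.mul (Measurable.pow ?_ ?_) ?_)
        (Measurable.mul (Measurable.pow ?_ ?_) hG2) <;> fun_prop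
    · have hae : ∀ᵐ p : ℝ × ℝ ∂((volume.restrict (Set.Ioi (0 : ℝ))).prod volume), 0 < p.1 :=
        Measure.quasiMeasurePreserving_fst.ae (ae_restrict_mem measurableSet_Ioi)
      filter_upwards [hae] with p hp
      simp only [Function.uncurry, hF, norm_mul]
      rw [Complex.norm_cpow_eq_rpow_re_of_pos hp, Complex.norm_cpow_eq_rpow_re_of_pos hy, hre,
        Complex.norm_exp]
      simp
  have hswap := integral_integral_swap hFint
  have hright (t : ℝ) : ∫ ξ in Set.Ioi (0 : ℝ), F ξ t =
      barnesIntegrand r c y (σ + t * Complex.I) := by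
    simp only [hF]
    rw [integral_mul_const, Complex.integral_cpow_mul_exp_neg_mul_Ioi (by simp; nlinarith) hc]
    rw [barnesIntegrand, mul_comm]
  have hleft (ξ : ℝ) (hξ : 0 < ξ) : ∫ t : ℝ, F ξ t = 2 * Real.pi *
      ((ξ ^ (r - 1) * Real.exp (-c * ξ) * Real.exp (-y * ξ ^ r) : ℝ) : ℂ) := by
    have hpt (t : ℝ) : F ξ t = ((ξ ^ (r - 1) * Real.exp (-c * ξ) : ℝ) : ℂ) *
        (((y * ξ ^ r : ℝ) : ℂ) ^ (-((σ : ℂ) + t * Complex.I)) *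
          Complex.Gamma (σ + t * Complex.I)) := by
      have hξr := Real.rpow_pos_of_pos hξ r
      have e1 : (ξ : ℂ) ^ ((r : ℂ) * (1 - ((σ : ℂ) + t * Complex.I)) - 1) =
          ((ξ ^ (r - 1) : ℝ) : ℂ) * ((ξ ^ r : ℝ) : ℂ) ^ (-((σ : ℂ) + t * Complex.I)) := by
        rw [Complex.ofReal_cpow hξ.le (r - 1), ofReal_cpow_eq_exp hξr, Real.log_rpow hξ,
          ofReal_cpow_eq_exp hξ, ofReal_cpow_eq_exp hξ, ← Complex.exp_add]
        congr 1
        push_cast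
        ring
      simp only [hF]
      rw [e1, Complex.ofReal_mul y, Complex.mul_cpow_ofReal_nonneg hy.le hξr.le, Complex.ofReal_mul,
        Complex.ofReal_exp]
      push_cast
      rw [neg_mul (c : ℂ)]
      ring
    simp_rw [hpt]
    rw [integral_const_mul, integral_cpow_mul_Gamma_vertical hσ (by positivity)]
    rw [neg_mul y]
    push_cast
    ring
  simp_rw [hright] at hswap
  rw [← hswap, setIntegral_congr_fun measurableSet_Ioi fun ξ hξ => hleft ξ hξ, integral_const_mul,
    integral_complex_ofReal]

/-! ### The Meijer function with the parameters `Δ(N, 1 - r)` and `Δ(D, 0)`, `r = N / D` -/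

theorem meijerKernel_deltaList {N D : ℕ} (hN : N ≠ 0) (hD : D ≠ 0) (ν : ℝ) (s : ℂ) :
    meijerKernel D N (deltaList N (-ν)) (deltaList D 0) s =
      (((2 * Real.pi) ^ (((D : ℝ) - 1) / 2) * √(D : ℝ) : ℝ) : ℂ) *
        ((D : ℂ) ^ (-((D : ℂ) * s)) * Complex.Gamma (D * s)) *
      ((((2 * Real.pi) ^ (((N : ℝ) - 1) / 2) * √(N : ℝ) : ℝ) : ℂ) *
        ((N : ℂ) ^ (-((ν : ℂ) + 1 - N * s)) * Complex.Gamma ((ν : ℂ) + 1 - N * s))) := by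
  have hN' : (N : ℂ) ≠ 0 := by exact_mod_cast hN
  have e : (ν : ℂ) + 1 - N * s = N * ((ν + 1) / N - s) := by field_simp
  rw [e, ← prod_Gamma_add_div D hD, ← prod_Gamma_add_div N hN, meijerKernel]
  congr 1
  · rw [Finset.prod_range]
    refine Finset.prod_congr rfl fun j _ => ?_
    rw [if_pos j.is_lt, deltaList]
    congr 1
    push_cast
    ring
  -- The order is reversed because `1 - a_j = (ν+1)/N + (N-1-j)/N`.
  · rw [← Finset.prod_range_reflect, Finset.prod_range]
    refine Finset.prod_congr rfl fun j _ => ?_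
    rw [if_pos j.is_lt, deltaList]
    have : ((N - 1 - (j : ℕ) : ℕ) : ℂ) = N - 1 - (j : ℕ) := by
      have := j.is_lt
      rw [Nat.sub_sub, Nat.cast_sub (by omega)]; push_cast; ring
    rw [this]
    congr 1
    push_cast
    field_simp
    ring

/-- The powers of `N` and `D` in `z` cancel the factors `N^{Ns}` and `D^{-Ds}` left by the
multiplication formula. -/
theorem meijerKernel_mul_cpow {N D : ℕ} (hN : N ≠ 0) (hD : D ≠ 0) {r c y z : ℝ}
    (hr : r = (N : ℝ) / D) (hc : 0 < c) (hy : 0 < y)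
    (hz : z = (N : ℝ) ^ N * y ^ D / ((D : ℝ) ^ D * c ^ N)) (s : ℂ) :
    meijerKernel D N (deltaList N (-(r - 1))) (deltaList D 0) s * (z : ℂ) ^ (-s) =
      (((2 * Real.pi) ^ (((N : ℝ) + D) / 2 - 1) * √(D : ℝ) * √(N : ℝ) * (N : ℝ) ^ (-r) * c ^ r : ℝ)
        : ℂ) * barnesIntegrand r c y (D * s) := by
  have hNpos : (0 : ℝ) < N := by exact_mod_cast Nat.pos_of_ne_zero hN
  have hDpos : (0 : ℝ) < D := by exact_mod_cast Nat.pos_of_ne_zero hD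
  have hzpos : 0 < z := by rw [hz]; positivity
  have hlz : Real.log z = N * Real.log N + D * Real.log y - D * Real.log D - N * Real.log c := by
    rw [hz, Real.log_div (by positivity) (by positivity), Real.log_mul (by positivity)
      (by positivity), Real.log_mul (by positivity) (by positivity), Real.log_pow, Real.log_pow,
      Real.log_pow, Real.log_pow]
    ring
  have hD' : (D : ℂ) ≠ 0 := by exact_mod_cast hD
  have hrD : (r : ℂ) * D = N := by
    rw [hr]; push_cast; field_simp
  have harg : (r : ℂ) * (1 - D * s) = ((r - 1 : ℝ) : ℂ) + 1 - N * s := by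
    rw [mul_sub, ← mul_assoc, hrD]; push_cast; ring
  have hpi : (2 * Real.pi) ^ (((N : ℝ) + D) / 2 - 1) =
      (2 * Real.pi) ^ (((D : ℝ) - 1) / 2) * (2 * Real.pi) ^ (((N : ℝ) - 1) / 2) := by
    rw [← Real.rpow_add (by positivity)]
    congr 1; ring
  have hexp : (D : ℂ) ^ (-((D : ℂ) * s)) * (N : ℂ) ^ (-(((r - 1 : ℝ) : ℂ) + 1 - N * s)) *
      (z : ℂ) ^ (-s) = (((N : ℝ) ^ (-r) * c ^ r : ℝ) : ℂ) * ((y : ℂ) ^ (-((D : ℂ) * s)) *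
        (1 / (c : ℂ)) ^ (((r - 1 : ℝ) : ℂ) + 1 - N * s)) := by
    have h1c : (1 / (c : ℂ)) = ((1 / c : ℝ) : ℂ) := by push_cast; rfl
    rw [Complex.ofReal_mul, Complex.ofReal_cpow hNpos.le, Complex.ofReal_cpow hc.le, h1c,
      ← Complex.ofReal_natCast D, ← Complex.ofReal_natCast N,
      ofReal_cpow_eq_exp hDpos, ofReal_cpow_eq_exp hNpos, ofReal_cpow_eq_exp hNpos,
      ofReal_cpow_eq_exp hzpos, ofReal_cpow_eq_exp hc, ofReal_cpow_eq_exp hy,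
      ofReal_cpow_eq_exp (by positivity : 0 < 1 / c), hlz]
    simp only [← Complex.exp_add]
    rw [one_div, Real.log_inv]
    congr 1
    push_cast
    ring
  rw [meijerKernel_deltaList hN hD, barnesIntegrand, harg, hpi]
  calc _ = (((2 * Real.pi) ^ (((D : ℝ) - 1) / 2) * √(D : ℝ) : ℝ) : ℂ) *
        (((2 * Real.pi) ^ (((N : ℝ) - 1) / 2) * √(N : ℝ) : ℝ) : ℂ) *
        ((D : ℂ) ^ (-((D : ℂ) * s)) * (N : ℂ) ^ (-(((r - 1 : ℝ) : ℂ) + 1 - N * s)) *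
          (z : ℂ) ^ (-s)) * (Complex.Gamma (D * s) *
          Complex.Gamma (((r - 1 : ℝ) : ℂ) + 1 - N * s)) := by ring
    _ = _ := by
      rw [hexp]
      push_cast
      ring

/-- The binding pole conditions are `j = 0` on the left and `j = N - 1` on the right, where `1 - a_j
= 1/D`. The forward direction is needed because `meijerG` uses an unspecified admissible line. -/
theorem isMeijerContour_deltaList {N D : ℕ} (hN : N ≠ 0) (hD : D ≠ 0) {r c y z σ : ℝ}
    (hr : r = (N : ℝ) / D) (hc : 0 < c) (hy : 0 < y)
    (hz : z = (N : ℝ) ^ N * y ^ D / ((D : ℝ) ^ D * c ^ N)) :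
    IsMeijerContour D N (deltaList N (-(r - 1))) (deltaList D 0) (z : ℂ) σ ↔
      0 < D * σ ∧ D * σ < 1 := by
  have hNpos : (0 : ℝ) < N := by exact_mod_cast Nat.pos_of_ne_zero hN
  have hDpos : (0 : ℝ) < D := by exact_mod_cast Nat.pos_of_ne_zero hD
  have hrpos : 0 < r := by rw [hr]; positivity
  constructor
  · intro h
    have h1 := h.left ⟨0, Nat.pos_of_ne_zero hD⟩ (Nat.pos_of_ne_zero hD)
    have h2 := h.right ⟨N - 1, by omega⟩ (by simp; omega)
    simp only [deltaList, Complex.ofReal_re] at h1 h2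
    rw [Nat.cast_sub (by omega)] at h2
    simp at h1
    refine ⟨mul_pos hDpos h1, ?_⟩
    have e : 1 - (-(r - 1) + ((N : ℝ) - (1 : ℕ))) / N = 1 / D := by
      rw [hr]; push_cast; field_simp; ring
    rw [e, lt_div_iff₀ hDpos] at h2
    linarith
  · rintro ⟨h1, h2⟩
    refine ⟨fun j _ => ?_, fun j _ => ?_, ?_⟩
    · have hσ : 0 < σ := pos_of_mul_pos_right h1 hDpos.le
      have : 0 ≤ ((0 : ℝ) + (j : ℕ)) / D := by positivity
      simp only [deltaList, Complex.ofReal_re]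
      linarith
    · simp only [deltaList, Complex.ofReal_re]
      have hj : ((j : ℕ) : ℝ) ≤ N - 1 := by
        have : (j : ℕ) + 1 ≤ N := j.is_lt
        have : (((j : ℕ) + 1 : ℕ) : ℝ) ≤ N := by exact_mod_cast this
        push_cast at this; linarith
      have e : 1 / (D : ℝ) = 1 - (-(r - 1) + ((N : ℝ) - 1)) / N := by
        rw [hr]; field_simp; ring
      have hle : (-(r - 1) + ((j : ℕ) : ℝ)) / N ≤ (-(r - 1) + ((N : ℝ) - 1)) / N := by gcongr
      have : σ < 1 / D := by rw [lt_div_iff₀ hDpos]; linarith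
      linarith
    · simp_rw [meijerKernel_mul_cpow hN hD hr hc hy hz]
      refine Integrable.const_mul ?_ _
      have h := (integrable_barnesIntegrand hrpos hc hy h1 h2).comp_mul_left' hDpos.ne'
      refine h.congr (Eventually.of_forall fun t => ?_)
      simp only
      congr 1
      push_cast
      ring

theorem meijerG_deltaList {N D : ℕ} (hN : N ≠ 0) (hD : D ≠ 0) {r c y z : ℝ}
    (hr : r = (N : ℝ) / D) (hc : 0 < c) (hy : 0 < y)
    (hz : z = (N : ℝ) ^ N * y ^ D / ((D : ℝ) ^ D * c ^ N)) :
    (∃ σ : ℝ, IsMeijerContour D N (deltaList N (-(r - 1))) (deltaList D 0) (z : ℂ) σ) ∧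
    ((∫ ξ in Set.Ioi (0 : ℝ), ξ ^ (r - 1) * Real.exp (-c * ξ) * Real.exp (-y * ξ ^ r) : ℝ) : ℂ) =
      ((1 / c ^ r * (√(D : ℝ) * (N : ℝ) ^ (r - 1 / 2) /
        (2 * Real.pi) ^ (((N : ℝ) + D) / 2 - 1)) : ℝ) : ℂ) *
        meijerG D N (deltaList N (-(r - 1))) (deltaList D 0) (z : ℂ) := by
  have hNpos : (0 : ℝ) < N := by exact_mod_cast Nat.pos_of_ne_zero hN
  have hDpos : (0 : ℝ) < D := by exact_mod_cast Nat.pos_of_ne_zero hD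
  have hrpos : 0 < r := by rw [hr]; positivity
  have hex : ∃ σ : ℝ, IsMeijerContour D N (deltaList N (-(r - 1))) (deltaList D 0) (z : ℂ) σ := by
    refine ⟨1 / 2 / D, (isMeijerContour_deltaList hN hD hr hc hy hz).2 ?_⟩
    rw [mul_div_cancel₀ _ hDpos.ne']
    norm_num
  refine ⟨hex, ?_⟩
  obtain ⟨h1, h2⟩ := (isMeijerContour_deltaList hN hD hr hc hy hz).1 hex.choose_spec
  rw [meijerG, dif_pos hex, meijerLineIntegral]
  -- Only the strip condition on `σ` is kept: `integral_barnesIntegrand` gives the same value on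
  -- every such line, so no contour shift is needed.
  generalize hex.choose = σ at h1 h2
  simp_rw [meijerKernel_mul_cpow hN hD hr hc hy hz]
  rw [integral_const_mul]
  have hsub : ∫ t : ℝ, barnesIntegrand r c y (D * (σ + t * Complex.I)) =
      ((D : ℝ)⁻¹ : ℝ) • ∫ t : ℝ, barnesIntegrand r c y ((D * σ : ℝ) + t * Complex.I) := by
    have h := Measure.integral_comp_mul_left
      (fun t : ℝ => barnesIntegrand r c y ((D * σ : ℝ) + t * Complex.I)) (D : ℝ)
    rw [abs_of_pos (inv_pos.2 hDpos)] at h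
    rw [← h]
    congr 1
    funext t
    congr 1
    push_cast
    ring
  rw [hsub, integral_barnesIntegrand hrpos hc hy h1 h2, Complex.real_smul]
  generalize (∫ ξ in Set.Ioi (0 : ℝ),
    ξ ^ (r - 1) * Real.exp (-c * ξ) * Real.exp (-y * ξ ^ r) : ℝ) = J
  rw [Real.rpow_sub hNpos, Real.rpow_neg hNpos.le, ← Real.sqrt_eq_rpow]
  have hone : 1 / c ^ r * (√(D : ℝ) * ((N : ℝ) ^ r / √(N : ℝ)) /
        (2 * Real.pi) ^ (((N : ℝ) + D) / 2 - 1)) * ((2 * Real.pi)⁻¹ *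
        ((2 * Real.pi) ^ (((N : ℝ) + D) / 2 - 1) * √(D : ℝ) * √(N : ℝ) * ((N : ℝ) ^ r)⁻¹ * c ^ r *
          ((D : ℝ)⁻¹ * (2 * Real.pi * J)))) = J := by
    have a1 : c ^ r ≠ 0 := (Real.rpow_pos_of_pos hc r).ne'
    have a2 : (N : ℝ) ^ r ≠ 0 := (Real.rpow_pos_of_pos hNpos r).ne'
    have a3 : (2 * Real.pi) ^ (((N : ℝ) + D) / 2 - 1) ≠ 0 :=
      (Real.rpow_pos_of_pos (by positivity) _).ne'
    have a4 : √(N : ℝ) ≠ 0 := (Real.sqrt_pos.2 hNpos).ne'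
    have a5 : √(D : ℝ) * √(D : ℝ) = D := Real.mul_self_sqrt hDpos.le
    have a6 := Real.pi_ne_zero
    generalize c ^ r = u1 at *
    generalize (N : ℝ) ^ r = u2 at *
    generalize (2 * Real.pi) ^ (((N : ℝ) + D) / 2 - 1) = u3 at *
    generalize √(N : ℝ) = u4 at *
    generalize √(D : ℝ) = u5 at *
    rw [← a5] at hDpos ⊢
    have a7 : u5 ≠ 0 := fun h => by simp [h] at hDpos
    field_simp
  conv_lhs => rw [← hone]
  push_cast
  rfl

/-! ### The series `T_I` -/

theorem Gamma_one_add_mul_factorial_le {ε : ℝ} (hε : 0 ≤ ε) (k : ℕ) :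
    Real.Gamma (1 + ε) * k.factorial ≤ Real.Gamma (1 + ε + k) := by
  induction k with
  | zero => simp
  | succ k ih =>
    have hpos : (0 : ℝ) < 1 + ε + k := by positivity
    have hΓ := (Real.Gamma_pos_of_pos hpos).le
    rw [Nat.cast_succ, ← add_assoc, Real.Gamma_add_one hpos.ne', Nat.factorial_succ]
    push_cast
    calc Real.Gamma (1 + ε) * (((k : ℝ) + 1) * k.factorial)
        = (k + 1) * (Real.Gamma (1 + ε) * k.factorial) := by ring
      _ ≤ (1 + ε + k) * Real.Gamma (1 + ε + k) :=
        mul_le_mul (by linarith) ih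
          (mul_nonneg (Real.Gamma_pos_of_pos (by linarith)).le (by positivity)) hpos.le

variable {Ω : Type*} [MeasurableSpace Ω] {P : Measure Ω} {g : Ω → ℝ}

theorem pow_mul_exp_neg_le {x : ℝ} (hx : 0 ≤ x) (k : ℕ) :
    x ^ k * Real.exp (-x) ≤ k.factorial := by
  have h := Real.pow_div_factorial_le_exp x hx k
  rw [div_le_iff₀ (by positivity)] at h
  rw [Real.exp_neg, ← div_eq_mul_inv, div_le_iff₀ (Real.exp_pos x)]
  linarith

/-- A first moment suffices: `x^k e^{-x} ≤ k!` at `x = s g` absorbs all but one power of `g`. -/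
theorem integrable_pow_mul_exp_neg (hg : ∀ᵐ ω ∂P, 0 ≤ g ω) (hgi : Integrable g P) {s : ℝ}
    (hs : 0 < s) (k : ℕ) :
    Integrable (fun ω => g ω ^ (k + 1) * Real.exp (-s * g ω)) P := by
  have hm := hgi.aestronglyMeasurable
  refine (hgi.norm.const_mul ((k.factorial : ℝ) / s ^ k)).mono' ?_ ?_
  · exact (hm.pow (k + 1)).mul (Real.continuous_exp.comp_aestronglyMeasurable (hm.const_mul (-s)))
  · filter_upwards [hg] with ω hω
    have h := pow_mul_exp_neg_le (mul_nonneg hs.le hω) k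
    rw [Real.norm_of_nonneg (by positivity), Real.norm_of_nonneg hω, div_mul_eq_mul_div,
      le_div_iff₀ (by positivity), neg_mul]
    calc g ω ^ (k + 1) * Real.exp (-(s * g ω)) * s ^ k
        = ((s * g ω) ^ k * Real.exp (-(s * g ω))) * g ω := by ring
      _ ≤ k.factorial * g ω := by gcongr

theorem mgfDerivI_nonneg (hg : ∀ᵐ ω ∂P, 0 ≤ g ω) (s : ℝ) (k : ℕ) : 0 ≤ mgfDerivI P g k s := by
  refine integral_nonneg_of_ae ?_
  filter_upwards [hg] with ω hω
  exact mul_nonneg (pow_nonneg hω _) (Real.exp_pos _).le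

theorem two_div_lt_one {α : ℝ} (hα : 2 < α) : 2 / α < 1 := by
  rw [div_lt_one (by linarith)]; exact hα

theorem termI_nonneg (hg : ∀ᵐ ω ∂P, 0 ≤ g ω) {α s : ℝ} (hα : 2 < α) (hs : 0 < s) (k : ℕ) :
    0 ≤ termI P g α s k := by
  have h := two_div_lt_one hα
  have hpos : 0 < 2 - 2 / α + k := by
    have : (0 : ℝ) ≤ k := k.cast_nonneg
    linarith
  exact mul_nonneg (mul_nonneg (by positivity) (mgfDerivI_nonneg hg s k))
    (inv_nonneg.2 (Real.Gamma_pos_of_pos hpos).le)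

/-- Under the expectation the sum is `s g e^{-sg}` times a partial sum of `e^{sg}`. -/
theorem sum_pow_mul_mgfDerivI_le (hg : ∀ᵐ ω ∂P, 0 ≤ g ω) (hgi : Integrable g P) {s : ℝ}
    (hs : 0 < s) (n : ℕ) :
    ∑ k ∈ Finset.range n, s ^ (k + 1) * mgfDerivI P g k s / k.factorial ≤ s * ∫ ω, g ω ∂P := by
  have hint (k : ℕ) := (integrable_pow_mul_exp_neg hg hgi hs k).const_mul
    (s ^ (k + 1) / (k.factorial : ℝ))
  have hterm (k : ℕ) : s ^ (k + 1) * mgfDerivI P g k s / k.factorial =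
      ∫ ω, s ^ (k + 1) / (k.factorial : ℝ) * (g ω ^ (k + 1) * Real.exp (-s * g ω)) ∂P := by
    rw [integral_const_mul, mgfDerivI]; ring
  simp_rw [hterm]
  rw [← integral_finsetSum _ fun k _ => hint k, ← integral_const_mul]
  refine integral_mono_ae (integrable_finsetSum _ fun k _ => hint k) (hgi.const_mul s) ?_
  filter_upwards [hg] with ω hω
  have hx := mul_nonneg hs.le hω
  calc ∑ k ∈ Finset.range n,
        s ^ (k + 1) / (k.factorial : ℝ) * (g ω ^ (k + 1) * Real.exp (-s * g ω))
      = (s * g ω) * Real.exp (-(s * g ω)) *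
          ∑ k ∈ Finset.range n, (s * g ω) ^ k / k.factorial := by
        rw [Finset.mul_sum]
        refine Finset.sum_congr rfl fun k _ => ?_
        rw [neg_mul]; ring
    _ ≤ (s * g ω) * Real.exp (-(s * g ω)) * Real.exp (s * g ω) := by
        gcongr
        exact Real.sum_le_exp_of_nonneg hx n
    _ = s * g ω := by rw [mul_assoc, ← Real.exp_add]; simp

theorem summable_termI (hg : ∀ᵐ ω ∂P, 0 ≤ g ω) (hgi : Integrable g P) {α s : ℝ} (hα : 2 < α)
    (hs : 0 < s) : Summable (termI P g α s) := by
  have h := two_div_lt_one hα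
  set ε := 1 - 2 / α with hε
  have hε0 : 0 ≤ ε := by linarith
  have hΓ : 0 < Real.Gamma (1 + ε) := Real.Gamma_pos_of_pos (by linarith)
  have hb : Summable fun k : ℕ => s ^ (k + 1) * mgfDerivI P g k s / (k.factorial : ℝ) :=
    summable_of_sum_range_le (fun k => div_nonneg (mul_nonneg (by positivity)
      (mgfDerivI_nonneg hg s k)) (by positivity)) (sum_pow_mul_mgfDerivI_le hg hgi hs)
  refine Summable.of_nonneg_of_le (termI_nonneg hg hα hs) (fun k => ?_)
    (hb.mul_left (Real.Gamma (1 + ε))⁻¹)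
  have hle := Gamma_one_add_mul_factorial_le hε0 k
  have e : 2 - 2 / α + k = 1 + ε + k := by rw [hε]; ring
  have hn : 0 ≤ s ^ (k + 1) * mgfDerivI P g k s :=
    mul_nonneg (by positivity) (mgfDerivI_nonneg hg s k)
  calc termI P g α s k = s ^ (k + 1) * mgfDerivI P g k s * (Real.Gamma (1 + ε + k))⁻¹ := by
        rw [termI, e]
    _ ≤ s ^ (k + 1) * mgfDerivI P g k s * (Real.Gamma (1 + ε) * k.factorial)⁻¹ := by
        gcongr
    _ = _ := by rw [mul_inv]; ring

theorem ZI_pos [IsProbabilityMeasure P] (hg : ∀ᵐ ω ∂P, 0 ≤ g ω) (hgi : Integrable g P) {α s : ℝ}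
    (hα : 2 < α) (hs : 0 < s) : 0 < ZI P g α s := by
  have hint : Integrable (fun ω => Real.exp (-s * g ω)) P := by
    refine (integrable_const (1 : ℝ)).mono'
      (Real.continuous_exp.comp_aestronglyMeasurable (hgi.aestronglyMeasurable.const_mul _)) ?_
    filter_upwards [hg] with ω hω
    rw [Real.norm_of_nonneg (Real.exp_pos _).le, Real.exp_le_one_iff]
    nlinarith
  have h := two_div_lt_one hα
  exact add_pos_of_pos_of_nonneg (ProbabilityTheory.mgf_pos hint)
    (mul_nonneg (Real.Gamma_pos_of_pos (by linarith)).le (tsum_nonneg (termI_nonneg hg hα hs)))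

/-! ### The integral in `G_I` -/

theorem integrableOn_innerIntegrand {lam α Z y : ℝ} (hlam : 0 < lam) (hα : 2 < α) (hZ : 0 < Z)
    (hy : 0 < y) : IntegrableOn (innerIntegrand lam α Z y) (Set.Ioi 0) := by
  have h := integrableOn_rpow_mul_exp_neg_mul_rpow (p := 1) (s := α / 2 - 1)
    (b := Real.pi * lam * Z) (by linarith) one_pos (by positivity)
  refine Integrable.mono' h (Measurable.aestronglyMeasurable ?_) ?_
  · unfold innerIntegrand; fun_prop
  · filter_upwards [ae_restrict_mem measurableSet_Ioi] with ξ hξ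
    have hξ' : 0 < ξ := hξ
    rw [innerIntegrand, Real.norm_of_nonneg (by positivity), Real.rpow_one]
    have e : -(Real.pi * lam * Z) * ξ = -Real.pi * lam * Z * ξ := by ring
    rw [e]
    refine mul_le_of_le_one_right (by positivity) ?_
    rw [Real.exp_le_one_iff]
    have := Real.rpow_pos_of_pos hξ' (α / 2)
    nlinarith

theorem integrableOn_exp_mul_exp_rpow {c y r : ℝ} (hc : 0 < c) (hy : 0 < y) :
    IntegrableOn (fun ξ : ℝ => Real.exp (-c * ξ) * Real.exp (-y * ξ ^ r)) (Set.Ioi 0) := by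
  refine Integrable.mono' (exp_neg_integrableOn_Ioi 0 hc)
    (Measurable.aestronglyMeasurable (by fun_prop)) ?_
  filter_upwards [ae_restrict_mem measurableSet_Ioi] with ξ hξ
  rw [Real.norm_of_nonneg (by positivity)]
  refine mul_le_of_le_one_right (by positivity) ?_
  rw [Real.exp_le_one_iff]
  have := Real.rpow_pos_of_pos hξ r
  nlinarith

/-- The combined integrand is the derivative of `-e^{-cξ} e^{-yξ^r}`, which rises from `-1` to `0`.
-/
theorem one_eq_integral_add_integral {c y r : ℝ} (hc : 0 < c) (hy : 0 < y) (hr : 1 < r)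
    (hI : IntegrableOn (fun ξ : ℝ => ξ ^ (r - 1) * Real.exp (-c * ξ) * Real.exp (-y * ξ ^ r))
      (Set.Ioi 0)) :
    c * (∫ ξ in Set.Ioi (0 : ℝ), Real.exp (-c * ξ) * Real.exp (-y * ξ ^ r)) +
      r * y * ∫ ξ in Set.Ioi (0 : ℝ), ξ ^ (r - 1) * Real.exp (-c * ξ) * Real.exp (-y * ξ ^ r) =
      1 := by
  have hA := integrableOn_exp_mul_exp_rpow (r := r) hc hy
  have hder : ∀ ξ ∈ Set.Ioi (0 : ℝ),
      HasDerivAt (fun ξ : ℝ => -(Real.exp (-c * ξ) * Real.exp (-y * ξ ^ r)))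
        (c * (Real.exp (-c * ξ) * Real.exp (-y * ξ ^ r)) +
          r * y * (ξ ^ (r - 1) * Real.exp (-c * ξ) * Real.exp (-y * ξ ^ r))) ξ := by
    intro ξ hξ
    have h1 : HasDerivAt (fun ξ : ℝ => Real.exp (-c * ξ)) (Real.exp (-c * ξ) * (-c * 1)) ξ :=
      ((hasDerivAt_id ξ).const_mul (-c)).exp
    have h2 : HasDerivAt (fun ξ : ℝ => Real.exp (-y * ξ ^ r))
        (Real.exp (-y * ξ ^ r) * (-y * (r * ξ ^ (r - 1)))) ξ :=
      ((Real.hasDerivAt_rpow_const (Or.inr hr.le)).const_mul (-y)).exp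
    convert! (h1.mul h2).neg using 1
    ring
  have hcont : Continuous fun ξ : ℝ => -(Real.exp (-c * ξ) * Real.exp (-y * ξ ^ r)) := by
    have := Real.continuous_rpow_const (q := r) (by linarith)
    fun_prop
  have hlim : Tendsto (fun ξ : ℝ => -(Real.exp (-c * ξ) * Real.exp (-y * ξ ^ r))) atTop (𝓝 0) := by
    have h1 : Tendsto (fun ξ : ℝ => Real.exp (-c * ξ)) atTop (𝓝 0) :=
      Real.tendsto_exp_atBot.comp (tendsto_id.const_mul_atTop_of_neg (by linarith))
    have h2 : Tendsto (fun ξ : ℝ => Real.exp (-y * ξ ^ r)) atTop (𝓝 0) :=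
      Real.tendsto_exp_atBot.comp
        ((tendsto_rpow_atTop (by linarith)).const_mul_atTop_of_neg (by linarith))
    simpa using (h1.mul h2).neg
  have h := integral_Ioi_of_hasDerivAt_of_tendsto hcont.continuousWithinAt hder
    ((hA.const_mul c).add (hI.const_mul (r * y))) hlim
  rw [integral_add (hA.const_mul c) (hI.const_mul (r * y)), integral_const_mul,
    integral_const_mul] at h
  rw [h, Real.zero_rpow (by linarith)]
  simp

/-- `G_I` after an integration by parts. -/
theorem GI_eq_integral {lam α snr y Z : ℝ} (hlam : 0 < lam) (hα : 2 < α) (hy : 0 < y)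
    (hZ : Z = ZI P g α (snr * y)) (hZpos : 0 < Z) :
    GI P g lam α snr y = Real.pi * lam *
      ∫ ξ in Set.Ioi (0 : ℝ), Real.exp (-(Real.pi * lam * Z) * ξ) * Real.exp (-y * ξ ^ (α / 2)) := by
  have hI := integrableOn_innerIntegrand hlam hα hZpos hy
  have e : innerIntegrand lam α Z y = fun ξ : ℝ =>
      ξ ^ (α / 2 - 1) * Real.exp (-(Real.pi * lam * Z) * ξ) * Real.exp (-y * ξ ^ (α / 2)) := by
    funext ξ
    rw [innerIntegrand]
    congr 3
    ring
  have h := one_eq_integral_add_integral (c := Real.pi * lam * Z) (y := y) (r := α / 2)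
    (by positivity) hy (by linarith) (by rwa [e] at hI)
  rw [GI, ← hZ, e]
  have hZ0 := hZpos.ne'
  generalize (∫ ξ in Set.Ioi (0 : ℝ), ξ ^ (α / 2 - 1) * Real.exp (-(Real.pi * lam * Z) * ξ) *
    Real.exp (-y * ξ ^ (α / 2))) = J at h ⊢
  generalize (∫ ξ in Set.Ioi (0 : ℝ), Real.exp (-(Real.pi * lam * Z) * ξ) *
    Real.exp (-y * ξ ^ (α / 2))) = A at h ⊢
  field_simp
  linarith

/-! ### Path-loss exponent four -/

theorem integral_exp_mul_exp_sq {c y : ℝ} (hy : 0 < y) :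
    ∫ ξ in Set.Ioi (0 : ℝ), Real.exp (-c * ξ) * Real.exp (-y * ξ ^ (2 : ℝ)) =
      1 / 2 * √(Real.pi / y) * Real.exp (c ^ 2 / (4 * y)) * erfc (c / (2 * √y)) := by
  have hsy : 0 < √y := Real.sqrt_pos.2 hy
  have hyy : √y * √y = y := Real.mul_self_sqrt hy.le
  have hpt (ξ : ℝ) : Real.exp (-c * ξ) * Real.exp (-y * ξ ^ (2 : ℝ)) =
      Real.exp (c ^ 2 / (4 * y)) * Real.exp (-(√y * (ξ + c / (2 * y))) ^ 2) := by
    rw [← Real.exp_add, ← Real.exp_add, Real.rpow_two, mul_pow, Real.sq_sqrt hy.le]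
    congr 1
    field_simp
    ring
  simp_rw [hpt]
  rw [integral_const_mul]
  have h1 := integral_comp_mul_left_Ioi (fun u : ℝ => Real.exp (-(u + c / (2 * √y)) ^ 2)) 0 hsy
  have h2 : ∫ u in Set.Ioi (0 : ℝ), Real.exp (-(u + c / (2 * √y)) ^ 2) =
      ∫ u in Set.Ioi (c / (2 * √y)), Real.exp (-u ^ 2) := by
    have := (measurePreserving_add_right volume (c / (2 * √y))).setIntegral_preimage_emb
      (measurableEmbedding_addRight _) (fun u : ℝ => Real.exp (-u ^ 2)) (Set.Ioi (c / (2 * √y)))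
    simpa using this
  have h3 (ξ : ℝ) : √y * (ξ + c / (2 * y)) = √y * ξ + c / (2 * √y) := by
    rw [mul_add]
    congr 1
    nth_rewrite 2 [← hyy]
    field_simp
  simp_rw [h3]
  rw [h1, mul_zero, h2, erfc, Real.sqrt_div Real.pi_pos.le, smul_eq_mul]
  have : √Real.pi ≠ 0 := (Real.sqrt_pos.2 Real.pi_pos).ne'
  field_simp

/-! ### Path-loss exponent six -/

/-- This integrability with positive `c` provides the dominating function for the termwise
integration. The tangent to `yξ³` at `a` gives `yξ³ ≥ 3dξ - 2ad`, whose slope beats `c` by more than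
1. -/
theorem integrableOn_exp_mul_exp_cube (c : ℝ) {y : ℝ} (hy : 0 < y) :
    IntegrableOn (fun ξ : ℝ => Real.exp (c * ξ) * Real.exp (-y * ξ ^ (3 : ℝ))) (Set.Ioi 0) := by
  set d := |c| + 1 with hd
  have hd0 : 0 < d := by positivity
  set a := √(d / y) with ha
  have ha0 : 0 ≤ a := Real.sqrt_nonneg _
  have hya : y * a ^ 2 = d := by rw [ha, Real.sq_sqrt (by positivity)]; field_simp
  refine Integrable.mono' ((exp_neg_integrableOn_Ioi 0 one_pos).const_mul (Real.exp (2 * a * d)))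
    (Measurable.aestronglyMeasurable (by fun_prop)) ?_
  filter_upwards [ae_restrict_mem measurableSet_Ioi] with ξ hξ
  have hξ' : 0 < ξ := hξ
  rw [Real.norm_of_nonneg (by positivity), ← Real.exp_add, ← Real.exp_add, Real.exp_le_exp]
  have h3 : ξ ^ (3 : ℝ) = ξ ^ 3 := by exact_mod_cast Real.rpow_natCast ξ 3
  rw [h3]
  have hcub : 0 ≤ y * ((ξ - a) ^ 2 * (ξ + 2 * a)) := by positivity
  have e : y * ((ξ - a) ^ 2 * (ξ + 2 * a)) = y * ξ ^ 3 - 3 * (y * a ^ 2) * ξ +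
      2 * a * (y * a ^ 2) := by ring
  rw [e, hya] at hcub
  have hcξ : c * ξ ≤ |c| * ξ := by gcongr; exact le_abs_self c
  have : |c| = d - 1 := by rw [hd]; ring
  rw [this] at hcξ
  nlinarith [mul_pos hd0 hξ']

theorem hasSum_integral_exp_mul_exp_cube {c y : ℝ} (hc : 0 < c) (hy : 0 < y) :
    HasSum (fun n : ℕ => (-c) ^ n / (n.factorial : ℝ) *
        (y ^ (-((n : ℝ) + 1) / 3) * (1 / 3) * Real.Gamma (((n : ℝ) + 1) / 3)))
      (∫ ξ in Set.Ioi (0 : ℝ), Real.exp (-c * ξ) * Real.exp (-y * ξ ^ (3 : ℝ))) := by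
  have hexp (x : ℝ) : HasSum (fun n : ℕ => x ^ n / (n.factorial : ℝ)) (Real.exp x) := by
    rw [Real.exp_eq_exp_ℝ]; exact NormedSpace.expSeries_div_hasSum_exp x
  have h := hasSum_integral_of_dominated_convergence
    (μ := volume.restrict (Set.Ioi (0 : ℝ)))
    (F := fun (n : ℕ) (ξ : ℝ) => (-c * ξ) ^ n / (n.factorial : ℝ) * Real.exp (-y * ξ ^ (3 : ℝ)))
    (f := fun ξ => Real.exp (-c * ξ) * Real.exp (-y * ξ ^ (3 : ℝ)))
    (fun (n : ℕ) (ξ : ℝ) => (c * ξ) ^ n / (n.factorial : ℝ) * Real.exp (-y * ξ ^ (3 : ℝ)))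
    (fun n => Measurable.aestronglyMeasurable (by fun_prop))
    (fun n => by
      filter_upwards [ae_restrict_mem measurableSet_Ioi] with ξ hξ
      have hξ' : 0 < ξ := hξ
      rw [norm_mul, norm_div, norm_pow, norm_mul, norm_neg, Real.norm_of_nonneg hc.le,
        Real.norm_of_nonneg hξ'.le, Real.norm_of_nonneg (Real.exp_pos _).le,
        Real.norm_of_nonneg (Nat.cast_nonneg _)])
    (Eventually.of_forall fun ξ => ((hexp (c * ξ)).mul_right _).summable)
    (by
      have he (ξ : ℝ) := ((hexp (c * ξ)).mul_right (Real.exp (-y * ξ ^ (3 : ℝ)))).tsum_eq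
      simp_rw [he]
      exact integrableOn_exp_mul_exp_cube c hy)
    (Eventually.of_forall fun ξ => (hexp (-c * ξ)).mul_right _)
  have hterm (n : ℕ) : ∫ ξ in Set.Ioi (0 : ℝ),
      (-c * ξ) ^ n / (n.factorial : ℝ) * Real.exp (-y * ξ ^ (3 : ℝ)) =
      (-c) ^ n / (n.factorial : ℝ) *
        (y ^ (-((n : ℝ) + 1) / 3) * (1 / 3) * Real.Gamma (((n : ℝ) + 1) / 3)) := by
    rw [← integral_rpow_mul_exp_neg_mul_rpow (by norm_num)
      (neg_one_lt_zero.trans_le n.cast_nonneg) hy, ← integral_const_mul]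
    refine setIntegral_congr_fun measurableSet_Ioi fun ξ _ => ?_
    simp only [Real.rpow_natCast]
    ring
  simpa only [hterm] using h

/-- This trades `Γ((n+1)/3) / n!` for the Bessel coefficients when `n` is `3k` or `3k+1`. -/
theorem Gamma_third_mul_Gamma_two_thirds (k : ℕ) :
    Real.Gamma (k + 1 / 3) * Real.Gamma (k + 2 / 3) * k.factorial * 27 ^ k =
      Real.Gamma (1 / 3) * Real.Gamma (2 / 3) * (3 * k).factorial := by
  induction k with
  | zero => simp
  | succ k ih =>
    have e1 : ((k + 1 : ℕ) : ℝ) + 1 / 3 = (k + 1 / 3) + 1 := by push_cast; ring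
    have e2 : ((k + 1 : ℕ) : ℝ) + 2 / 3 = (k + 2 / 3) + 1 := by push_cast; ring
    rw [e1, e2, Real.Gamma_add_one (by positivity), Real.Gamma_add_one (by positivity),
      Nat.factorial_succ, show 3 * (k + 1) = 3 * k + 1 + 1 + 1 by ring, Nat.factorial_succ,
      Nat.factorial_succ, Nat.factorial_succ]
    push_cast
    linear_combination ((3 * (k : ℝ) + 1) * (3 * k + 2) * (3 * k + 3)) * ih

/-- Each factor is `4(3i+1)(3i+2)/9`; supplying the missing multiples of 3 completes the factorial.
-/
theorem prod_lommel_third (k : ℕ) :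
    (∏ i ∈ Finset.range (k + 1), (((0 : ℝ) + 2 * (i : ℝ) + 1) ^ 2 - (1 / 3 : ℝ) ^ 2) : ℝ) *
      ((27 : ℝ) ^ (k + 1) * ((k + 1).factorial : ℝ)) =
        (4 : ℝ) ^ (k + 1) * ((3 * (k + 1)).factorial : ℝ) := by
  induction k with
  | zero => norm_num [Nat.factorial]
  | succ k ih =>
    rw [Finset.prod_range_succ, Nat.factorial_succ (k + 1),
      show 3 * (k + 1 + 1) = 3 * (k + 1) + 1 + 1 + 1 by ring, Nat.factorial_succ (3 * (k + 1) + 1 + 1),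
      Nat.factorial_succ (3 * (k + 1) + 1), Nat.factorial_succ (3 * (k + 1))]
    push_cast
    linear_combination (27 * ((2 * ((k : ℝ) + 1) + 1) ^ 2 - 1 / 9) * ((k : ℝ) + 2)) * ih

/-- Both cosines equal `cos(π/6) = sin(π/3)` and cancel the denominator. -/
theorem lommelS_zero_third (x : ℝ) :
    lommelS 0 (1 / 3) x = lommelLower 0 (1 / 3) x +
      Real.Gamma (1 / 3) * Real.Gamma (2 / 3) / 2 *
        (besselJ (-(1 / 3)) x - besselJ (1 / 3) x) := by
  have h1 : ((0 : ℝ) - 1 / 3 + 1) / 2 = 1 / 3 := by norm_num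
  have h2 : ((0 : ℝ) + 1 / 3 + 1) / 2 = 2 / 3 := by norm_num
  have h3 : (1 / 3 : ℝ) * Real.pi = Real.pi / 3 := by ring
  have h4 : ((0 : ℝ) - 1 / 3) / 2 * Real.pi = -(Real.pi / 6) := by ring
  have h5 : ((0 : ℝ) + 1 / 3) / 2 * Real.pi = Real.pi / 6 := by ring
  have h6 : (2 : ℝ) ^ ((0 : ℝ) - 1) = 1 / 2 := by
    rw [zero_sub, Real.rpow_neg_one]; norm_num
  have hs : √3 ≠ 0 := by positivity
  rw [lommelS, h1, h2, h3, h4, h5, h6, Real.cos_neg, Real.sin_pi_div_three, Real.cos_pi_div_six]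
  field_simp

/-- Writing the coefficients as `a²` and `b⁶` makes every root that occurs a monomial in `a`, `b`
and `√3`. Below, `t0`, `t1`, `t2` match the residue classes with `J_{-1/3}`, `-J_{1/3}` and the
lower Lommel series. -/
theorem integral_exp_mul_exp_cube_eq_lommelS {a b : ℝ} (ha : 0 < a) (hb : 0 < b) :
    ∫ ξ in Set.Ioi (0 : ℝ), Real.exp (-(a ^ 2) * ξ) * Real.exp (-(b ^ 6) * ξ ^ (3 : ℝ)) =
      2 * √(a ^ 2 / (27 * b ^ 6)) * lommelS 0 (1 / 3) (2 * √((a ^ 2) ^ 3 / (27 * b ^ 6))) := by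
  have hsum := hasSum_integral_exp_mul_exp_cube (pow_pos ha 2) (pow_pos hb 6)
  rw [← hsum.tsum_eq]
  set f : ℕ → ℝ := fun n => (-(a ^ 2)) ^ n / (n.factorial : ℝ) *
        ((b ^ 6) ^ (-((n : ℝ) + 1) / 3) * (1 / 3) * Real.Gamma (((n : ℝ) + 1) / 3)) with hf
  have hf' (n : ℕ) : f n = (-(a ^ 2)) ^ n / (n.factorial : ℝ) *
      ((b ^ (2 * (n + 1)))⁻¹ * (1 / 3) * Real.Gamma (((n : ℝ) + 1) / 3)) := by
    rw [hf]
    simp only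
    congr 3
    rw [← Real.rpow_natCast b 6, ← Real.rpow_mul hb.le, ← Real.rpow_natCast, ← Real.rpow_neg hb.le]
    congr 1
    push_cast
    ring
  have hres : ∑' n, f n = ∑ j : Fin 3, ∑' m : ℕ, f ((j : ℕ) + 3 * m) :=
    Nat.sumByResidueClasses hsum.summable 3
  set w := √3 with hw
  have hw0 : 0 < w := by positivity
  have hw2 : w ^ 2 = 3 := Real.sq_sqrt (by norm_num)
  have hw6 : w ^ 6 = 27 := by rw [show w ^ 6 = (w ^ 2) ^ 3 by ring, hw2]; norm_num
  -- The Lommel argument is `2v³`, so `(x/2)^{2k ∓ 1/3} = v^{6k ∓ 1}` has integer exponents.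
  set v := a / (w * b) with hv
  have hv0 : 0 < v := by positivity
  have hK : √(a ^ 2 / (27 * b ^ 6)) = a / (w * b) ^ 3 := by
    rw [Real.sqrt_eq_iff_eq_sq (by positivity) (by positivity), ← hw6]
    field_simp
  have hx : √((a ^ 2) ^ 3 / (27 * b ^ 6)) = v ^ 3 := by
    rw [Real.sqrt_eq_iff_eq_sq (by positivity) (by positivity), ← hw6, hv]
    field_simp
  have hvp (t : ℝ) : (v ^ 3) ^ t = v ^ (3 * t) := by
    rw [← Real.rpow_natCast v 3, ← Real.rpow_mul hv0.le]; norm_num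
  rw [hres, Fin.sum_univ_three, hK, hx, lommelS_zero_third, lommelLower, besselJ, besselJ]
  set G := Real.Gamma (1 / 3) * Real.Gamma (2 / 3) with hG
  have hv6 (k : ℕ) : v ^ (6 * k) = a ^ (6 * k) / (27 ^ k * b ^ (6 * k)) := by
    rw [hv, div_pow, mul_pow, pow_mul w, hw6]
  have hΓ1 (k : ℕ) : 0 < Real.Gamma (k + 1 / 3) := Real.Gamma_pos_of_pos (by positivity)
  have hΓ2 (k : ℕ) : 0 < Real.Gamma (k + 2 / 3) := Real.Gamma_pos_of_pos (by positivity)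
  have hGpos : 0 < G := by simpa [hG] using mul_pos (hΓ1 0) (hΓ2 0)
  have hsgn (k : ℕ) : (-(a ^ 2)) ^ (3 * k) = (-1) ^ k * a ^ (6 * k) := by
    rw [pow_mul, show (-(a ^ 2)) ^ 3 = (-1) * a ^ 6 by ring, mul_pow, pow_mul a]
  have t0 (k : ℕ) : f (((0 : Fin 3) : ℕ) + 3 * k) = 2 * (a / (w * b) ^ 3) * (G / 2) *
      ((-1) ^ k / ((k.factorial : ℝ) * Real.Gamma (-(1 / 3) + k + 1)) *
        (2 * v ^ 3 / 2) ^ (2 * (k : ℝ) + -(1 / 3))) := by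
    rw [mul_div_cancel_left₀ _ two_ne_zero, hvp,
      show 3 * (2 * (k : ℝ) + -(1 / 3)) = ((6 * k : ℕ) : ℝ) - 1 by push_cast; ring,
      Real.rpow_sub hv0, Real.rpow_one, Real.rpow_natCast, hv6, hf',
      show (-(1 / 3) + (k : ℝ) + 1) = k + 2 / 3 by ring]
    have e : (((((0 : Fin 3) : ℕ) + 3 * k : ℕ) : ℝ) + 1) / 3 = k + 1 / 3 := by
      simp; ring
    rw [e]
    have hid := Gamma_third_mul_Gamma_two_thirds k
    rw [← hG] at hid
    have h1 := (hΓ1 k).ne'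
    have h2 := (hΓ2 k).ne'
    have hq : Real.Gamma (k + 1 / 3) / ((3 * k).factorial : ℝ) =
        G / (Real.Gamma (k + 2 / 3) * k.factorial * 27 ^ k) := by
      rw [div_eq_div_iff (by positivity) (by positivity)]
      linear_combination hid
    simp only [Fin.val_zero, zero_add]
    rw [hsgn, hv, show 2 * (3 * k + 1) = 6 * k + 2 by ring, pow_add b]
    calc _ = (-1) ^ k * a ^ (6 * k) * (b ^ (6 * k) * b ^ 2)⁻¹ * (1 / 3) *
          (Real.Gamma (k + 1 / 3) / ((3 * k).factorial : ℝ)) := by ring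
      _ = _ := by
        rw [hq, ← hw2]
        field_simp
  have t1 (k : ℕ) : f (((1 : Fin 3) : ℕ) + 3 * k) = -(2 * (a / (w * b) ^ 3) * (G / 2)) *
      ((-1) ^ k / ((k.factorial : ℝ) * Real.Gamma (1 / 3 + k + 1)) *
        (2 * v ^ 3 / 2) ^ (2 * (k : ℝ) + 1 / 3)) := by
    have e : (((((1 : Fin 3) : ℕ) + 3 * k : ℕ) : ℝ) + 1) / 3 = k + 2 / 3 := by
      simp; ring
    rw [mul_div_cancel_left₀ _ two_ne_zero, hvp,
      show 3 * (2 * (k : ℝ) + 1 / 3) = ((6 * k : ℕ) : ℝ) + 1 by push_cast; ring,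
      Real.rpow_add hv0, Real.rpow_one, Real.rpow_natCast, hv6, hf', e,
      show (1 / 3 + (k : ℝ) + 1) = (k + 1 / 3) + 1 by ring, Real.Gamma_add_one (by positivity)]
    have hid := Gamma_third_mul_Gamma_two_thirds k
    rw [← hG] at hid
    have h1 := (hΓ1 k).ne'
    have h2 := (hΓ2 k).ne'
    have hq : Real.Gamma (k + 2 / 3) / ((3 * k).factorial : ℝ) =
        G / (Real.Gamma (k + 1 / 3) * k.factorial * 27 ^ k) := by
      rw [div_eq_div_iff (by positivity) (by positivity)]
      linear_combination hid
    simp only [Fin.val_one]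
    have hk : (3 : ℝ) * k + 1 ≠ 0 := by positivity
    rw [add_comm 1 (3 * k), pow_succ (-(a ^ 2)), hsgn, hv,
      show 2 * (3 * k + 1 + 1) = 6 * k + 4 by ring, pow_add b, Nat.factorial_succ]
    push_cast
    calc _ = -((-1) ^ k * a ^ (6 * k) * a ^ 2 * (b ^ (6 * k) * b ^ 4)⁻¹ * (1 / 3) / (3 * k + 1) *
          (Real.Gamma (k + 2 / 3) / ((3 * k).factorial : ℝ))) := by field_simp
      _ = -((-1) ^ k * a ^ (6 * k) * a ^ 2 * (b ^ (6 * k) * b ^ 4)⁻¹ * (1 / w ^ 4) / (k + 1 / 3) *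
          (Real.Gamma (k + 2 / 3) / ((3 * k).factorial : ℝ))) := by
        rw [show w ^ 4 = (w ^ 2) ^ 2 by ring, hw2]
        field_simp
      _ = _ := by
        rw [hq]
        field_simp
  have t2 (k : ℕ) : f (((2 : Fin 3) : ℕ) + 3 * k) = 2 * (a / (w * b) ^ 3) *
      ((-1) ^ k * (2 * v ^ 3) ^ (0 + 1 + 2 * (k : ℝ)) /
        ∏ i ∈ Finset.range (k + 1), ((0 + 2 * (i : ℝ) + 1) ^ 2 - (1 / 3) ^ 2)) := by
    have e : (((((2 : Fin 3) : ℕ) + 3 * k : ℕ) : ℝ) + 1) / 3 = k + 1 := by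
      simp; ring
    rw [show 0 + 1 + 2 * (k : ℝ) = ((2 * k + 1 : ℕ) : ℝ) by push_cast; ring, Real.rpow_natCast,
      hf', e, Real.Gamma_nat_eq_factorial]
    have hid := prod_lommel_third k
    have hprod : (∏ i ∈ Finset.range (k + 1), (((0 : ℝ) + 2 * (i : ℝ) + 1) ^ 2 - (1 / 3) ^ 2)) =
        4 ^ (k + 1) * ((3 * (k + 1)).factorial : ℝ) / (27 ^ (k + 1) * (k + 1).factorial) := by
      rw [eq_div_iff (by positivity)]
      exact hid
    have hvk : (2 * v ^ 3) ^ (2 * k + 1) =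
        2 * 4 ^ k * (a ^ (6 * k) / (27 ^ k * b ^ (6 * k))) * v ^ 3 := by
      rw [pow_succ, pow_mul, ← hv6, show (2 * v ^ 3) ^ 2 = 4 * v ^ 6 by ring, mul_pow, ← pow_mul]
      ring
    simp only [Fin.val_two]
    rw [hprod, hvk, add_comm 2 (3 * k), pow_add (-(a ^ 2)), hsgn, hv,
      show 2 * (3 * k + 2 + 1) = 6 * k + 6 by ring, pow_add b,
      show 3 * (k + 1) = 3 * k + 2 + 1 by ring, Nat.factorial_succ (3 * k + 2),
      Nat.factorial_succ k, pow_succ (27 : ℝ), pow_succ (4 : ℝ)]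
    rw [show (27 : ℝ) ^ k * 27 = 27 ^ k * w ^ 6 by rw [hw6]]
    push_cast
    field_simp
    ring
  simp_rw [t0, t1, t2]
  rw [tsum_mul_left, tsum_mul_left, tsum_mul_left]
  ring

end CellularRate

end

/-! ### Assembly of the three closed forms -/

theorem corollary1 {Ω : Type*} [MeasurableSpace Ω] (P : MeasureTheory.Measure Ω)
    [MeasureTheory.IsProbabilityMeasure P]
    (g : Ω → ℝ) (hg_nonneg : ∀ᵐ ω ∂P, 0 ≤ g ω) (hg_int : MeasureTheory.Integrable g P)
    (lam α snr y : ℝ) (hlam : 0 < lam) (hα : 2 < α) (hsnr : 0 < snr) (hy : 0 < y)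
    (Z : ℝ) (hZ : Z = CellularRate.ZI P g α (snr * y))
    (ν : ℝ) (hν : ν = α / 2 - 1) :
    -- all quantities are well defined
    (Summable (CellularRate.termI P g α (snr * y)) ∧ 0 < Z ∧
      MeasureTheory.IntegrableOn (CellularRate.innerIntegrand lam α Z y) (Set.Ioi 0)) ∧
    -- path-loss exponent 4
    (α = 4 →
      CellularRate.GI P g lam α snr y =
        Real.pi * lam / 2 * √(Real.pi / y) *
          Real.exp ((Real.pi * lam) ^ 2 * Z ^ 2 / (4 * y)) *
          CellularRate.erfc (Real.pi * lam * Z / (2 * √y))) ∧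
    -- path-loss exponent 6
    (α = 6 →
      CellularRate.GI P g lam α snr y =
        2 * (Real.pi * lam) * √(Real.pi * lam * Z / (27 * y)) *
          CellularRate.lommelS 0 (1 / 3)
            (2 * √((Real.pi * lam) ^ 3 * Z ^ 3 / (27 * y)))) ∧
    -- rational path-loss exponent
    (∀ N D : ℕ, 0 < N → 0 < D → α / 2 = (N : ℝ) / (D : ℝ) →
      ∀ z : ℝ, z = (N : ℝ) ^ N * y ^ D / ((D : ℝ) ^ D * (Real.pi * lam) ^ N * Z ^ N) →
        (∃ σ : ℝ, CellularRate.IsMeijerContour D N (CellularRate.deltaList N (-ν))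
          (CellularRate.deltaList D 0) (z : ℂ) σ) ∧
        (CellularRate.GI P g lam α snr y : ℂ) =
          ((1 / Z : ℝ) : ℂ) -
            ((α / 2 * (y / ((Real.pi * lam) ^ (ν + 1) * Z ^ (ν + 2))) *
              (√(D : ℝ) * (N : ℝ) ^ (ν + 1 / 2) /
                (2 * Real.pi) ^ (((N : ℝ) + (D : ℝ)) / 2 - 1)) : ℝ) : ℂ) *
            CellularRate.meijerG D N (CellularRate.deltaList N (-ν))
              (CellularRate.deltaList D 0) (z : ℂ)) := by
  have hs : 0 < snr * y := mul_pos hsnr hy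
  have hZpos : 0 < Z := hZ ▸ CellularRate.ZI_pos hg_nonneg hg_int hα hs
  have hc : 0 < Real.pi * lam * Z := by positivity
  have hGI := CellularRate.GI_eq_integral (snr := snr) hlam hα hy hZ hZpos
  refine ⟨⟨CellularRate.summable_termI hg_nonneg hg_int hα hs, hZpos,
    CellularRate.integrableOn_innerIntegrand hlam hα hZpos hy⟩, ?_, ?_, ?_⟩
  · intro h4
    rw [hGI, h4, show (4 : ℝ) / 2 = 2 by norm_num, CellularRate.integral_exp_mul_exp_sq hy, mul_pow]
    ring
  · intro h6
    rw [hGI, h6, show (6 : ℝ) / 2 = 3 by norm_num]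
    have ha : √(Real.pi * lam * Z) ^ 2 = Real.pi * lam * Z := Real.sq_sqrt hc.le
    have hb : (y ^ (1 / 6 : ℝ)) ^ 6 = y := by
      rw [← Real.rpow_mul_natCast hy.le]; norm_num
    have h := CellularRate.integral_exp_mul_exp_cube_eq_lommelS (Real.sqrt_pos.2 hc)
      (Real.rpow_pos_of_pos hy (1 / 6))
    rw [ha, hb] at h
    rw [h, mul_pow (Real.pi * lam)]
    ring
  · intro N D hN hD hND z hz
    -- Here the integral in the definition of `GI` is evaluated directly, with `c = πλZ`.
    have hz' : z = (N : ℝ) ^ N * y ^ D / ((D : ℝ) ^ D * (Real.pi * lam * Z) ^ N) := by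
      rw [hz, mul_pow (Real.pi * lam), mul_assoc ((D : ℝ) ^ D)]
    obtain ⟨hex, hJ⟩ := CellularRate.meijerG_deltaList hN.ne' hD.ne' hND hc hy hz'
    rw [hν]
    refine ⟨hex, ?_⟩
    have hinner : ∫ ξ in Set.Ioi (0 : ℝ), CellularRate.innerIntegrand lam α Z y ξ =
        ∫ ξ in Set.Ioi (0 : ℝ), ξ ^ (α / 2 - 1) * Real.exp (-(Real.pi * lam * Z) * ξ) *
          Real.exp (-y * ξ ^ (α / 2)) := by
      congr 1
      funext ξ
      rw [CellularRate.innerIntegrand]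
      congr 3
      ring
    rw [CellularRate.GI, ← hZ, Complex.ofReal_sub, Complex.ofReal_mul, hinner, hJ, ← mul_assoc,
      ← Complex.ofReal_mul]
    congr 3
    have e1 : α / 2 - 1 + 1 = α / 2 := by ring
    have e2 : α / 2 - 1 + 2 = α / 2 + 1 := by ring
    have e3 : α / 2 - 1 + 1 / 2 = α / 2 - 1 / 2 := by ring
    rw [e1, e2, e3, Real.rpow_add hZpos, Real.rpow_one,
      Real.mul_rpow (by positivity) hZpos.le]
    have h1 := (Real.rpow_pos_of_pos (mul_pos Real.pi_pos hlam) (α / 2)).ne'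
    have h2 := (Real.rpow_pos_of_pos hZpos (α / 2)).ne'
    field_simp
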